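/- **Theorem 1.7 (polylogarithms).** Let $\mathbb D=\{z\in\mathbb C:|z|<1\}$ and, for real $\alpha$, let $\operatorname{Li}_\alpha(z)=\sum_{n=1}^\infty z^n/n^\alpha$ $(z\in\mathbb D)$. A complex-valued harmonic function $f$ on $\mathbb D$ is called *$k$-quasiconformal* on $\mathbb D$, for a real constant $k<1$, if it is injective and sense-preserving, i.e. $J_f=|f_z|^2-|f_{\bar z}|^2>0$ on $\mathbb D$, and its second complex dilatation $\omega_f=\overline{f_{\bar z}}/f_z$ satisfies $|\omega_f|\le k$ on $\mathbb D$. Let $\alpha,\beta\ge 1$ and $c\ge 0$ be real constants, and set $f=\operatorname{Li}_\alpha+c\,\overline{\operatorname{Li}_\beta}$ on $\mathbb D$. Then: (i) $f$ is $k$-quasiconformal on $\mathbb D$ whenever $\alpha\le\beta$ and $2c\le k<1$; (ii) $f$ is $k$-quasiconformal on $\mathbb D$ whenever $2<\beta\le\alpha$ and $c\,\zeta(\beta-1)/\zeta(\alpha-1)\le k<1$, where $\zeta(s)=\sum_{n=1}^\infty n^{-s}$ is the Riemann zeta function. -/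

import Mathlib

/-- The polylogarithm of real order `α`, `Li_α(z) = ∑_{n ≥ 1} z ^ n / n ^ α`.
The series converges absolutely for `‖z‖ < 1`; it is used only there. -/
noncomputable def polylog (α : ℝ) (z : ℂ) : ℂ :=
  ∑' n : ℕ, z ^ (n + 1) / (((n + 1 : ℝ) ^ α : ℝ) : ℂ)

/-- The Wirtinger derivative `f_z = (f_x - i f_y) / 2`. -/
noncomputable def wirtingerDz (f : ℂ → ℂ) (z : ℂ) : ℂ :=
  (fderiv ℝ f z 1 - Complex.I * fderiv ℝ f z Complex.I) / 2

/-- The Wirtinger derivative `f_{z̄} = (f_x + i f_y) / 2`. -/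
noncomputable def wirtingerDzbar (f : ℂ → ℂ) (z : ℂ) : ℂ :=
  (fderiv ℝ f z 1 + Complex.I * fderiv ℝ f z Complex.I) / 2

/-- The Jacobian `J_f = |f_z|² - |f_{z̄}|²`. -/
noncomputable def wirtingerJacobian (f : ℂ → ℂ) (z : ℂ) : ℝ :=
  ‖wirtingerDz f z‖ ^ 2 - ‖wirtingerDzbar f z‖ ^ 2

/-- The second complex dilatation `ω_f = conj (f_{z̄}) / f_z`. It is used only at points
where the Jacobian is positive, so that `f_z ≠ 0`. -/
noncomputable def secondDilatation (f : ℂ → ℂ) (z : ℂ) : ℂ :=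
  (starRingEnd ℂ) (wirtingerDzbar f z) / wirtingerDz f z

/-- `f` is a `k`-quasiconformal harmonic mapping on the open set `U`: a complex-valued
harmonic function on `U` that is univalent, i.e. injective and sense-preserving,
and whose second complex dilatation is bounded by the constant `k < 1`. -/
structure IsHarmonicQuasiconformalOn (k : ℝ) (f : ℂ → ℂ) (U : Set ℂ) : Prop where
  harmonic : InnerProductSpace.HarmonicOnNhd f U
  injOn : Set.InjOn f U
  sense_preserving : ∀ z ∈ U, 0 < wirtingerJacobian f z
  k_lt_one : k < 1
  dilatation_le : ∀ z ∈ U, ‖secondDilatation f z‖ ≤ k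

/-! Write `Q_s` for `polylogQuot s`, so `Li_s(z) = z Q_s(z)` and `Li_s' = Q_{s-1}`. For `f = h +
conj g` with `h = Li_α`, `g = c Li_β`, one has `f_z = h' = Q_{α-1}` and `conj f_z̄ = g' = c
Q_{β-1}`. The dilatation and Jacobian conditions therefore both reduce to `c |Q_{β-1}| ≤ k
|Q_{α-1}|`, and injectivity is the other task.

The estimate comes from Kaluza's argument (`exists_nonneg_cauchy_quotient`): dividing by a power
series with log-convex coefficients yields nonnegative coefficients when the coefficient ratio
increases. If `α ≤ β`, it is applied to the difference of the two series and puts `Q_{β-1}/Q_{α-1}`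
in the disc of radius 1 about 1, whence the factor 2. If `2 < β ≤ α`, the quotient itself has
nonnegative coefficients, so its modulus is at most its value at 1, namely `ζ(β-1)/ζ(α-1)`.

For injectivity, `h` is injective since `Re h' > 0`, and it maps circles about 0 to convex curves
since `z h' = Li_{α-1}` is starlike. Along a segment in the convex image, `|g'| ≤ k |h'|` gives `|g
x - g y| ≤ k |h x - h y|`; but `f x = f y` forces equality of these two distances, hence `h x = h y`
as `k < 1`. The code replaces segments by an extremal argument that needs only supporting lines
(`norm_sub_le_of_supporting`, `polylog_circle_supporting`).

Starlikeness of `Li_s` for `s ≥ 1` is again Kaluza. For `0 < s < 1` the coefficients of `Q_{s-1}`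
grow, and integral representations with an increasing ratio of weights are compared instead
(`setIntegral_mul_conj_im_nonpos`). -/

/-! ### Quotients of power series with log-convex coefficients -/

-- Kaluza's induction: the recursion for `p (n + 1)` isolates `r (n + 1)`. The other terms form the
-- recursion for `p n` with each `q l` replaced by `q (l + 1)`, which by log-convexity costs a
-- factor of at most `q (n + 1) / q n`; as `p / q` increases, their sum is at most `p (n + 1)`.
open Finset in
theorem exists_nonneg_cauchy_quotient {p q : ℕ → ℝ} (hq0 : q 0 = 1) (hq : ∀ n, 0 < q n)
    (hlc : Monotone fun n => q (n + 1) / q n) (hp0 : 0 ≤ p 0)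
    (hpq : ∀ n, p n * q (n + 1) ≤ p (n + 1) * q n) :
    ∃ r : ℕ → ℝ, (∀ n, 0 ≤ r n) ∧ ∀ n, ∑ kl ∈ antidiagonal n, r kl.1 * q kl.2 = p n := by
  set R : PowerSeries ℝ := PowerSeries.mk p * (PowerSeries.mk q)⁻¹ with hR
  have hconv : ∀ n, ∑ kl ∈ antidiagonal n, PowerSeries.coeff kl.1 R * q kl.2 = p n := by
    intro n
    have h : R * PowerSeries.mk q = PowerSeries.mk p := by
      rw [hR, mul_assoc, PowerSeries.inv_mul_cancel, mul_one]
      simp [hq0]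
    have := congrArg (PowerSeries.coeff n) h
    rw [PowerSeries.coeff_mul] at this
    simpa using this
  refine ⟨fun n => PowerSeries.coeff n R, fun n => ?_, hconv⟩
  induction n using Nat.strong_induction_on with
  | _ n ih =>
    cases n with
    | zero => have := hconv 0; simp [hq0] at this; simpa [this] using hp0
    | succ n =>
      have h1 := hconv (n + 1)
      rw [Nat.sum_antidiagonal_succ', hq0, mul_one] at h1
      have h2 : ∑ kl ∈ antidiagonal n, PowerSeries.coeff kl.1 R * q (kl.2 + 1) ≤
          q (n + 1) / q n * p n := by
        rw [← hconv n, mul_sum]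
        refine sum_le_sum fun kl hkl => ?_
        have hkl' := mem_antidiagonal.1 hkl
        have h3 : q (kl.2 + 1) ≤ q (n + 1) / q n * q kl.2 :=
          (div_le_iff₀ (hq _)).1 (hlc (by omega : kl.2 ≤ n))
        calc _ ≤ PowerSeries.coeff kl.1 R * (q (n + 1) / q n * q kl.2) :=
              mul_le_mul_of_nonneg_left h3 (ih _ (by omega))
          _ = _ := by ring
      have h4 : q (n + 1) / q n * p n ≤ p (n + 1) := by
        rw [div_mul_eq_mul_div, div_le_iff₀ (hq n)]
        linarith [hpq n]
      show 0 ≤ PowerSeries.coeff (n + 1) R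
      linarith

theorem le_of_cauchy_product {r q : ℕ → ℝ} (hr : ∀ n, 0 ≤ r n) (hq0 : q 0 = 1)
    (hq : ∀ n, 0 ≤ q n) (n : ℕ) :
    r n ≤ ∑ kl ∈ Finset.HasAntidiagonal.antidiagonal n, r kl.1 * q kl.2 := by
  have := Finset.single_le_sum (f := fun kl : ℕ × ℕ => r kl.1 * q kl.2)
    (s := Finset.HasAntidiagonal.antidiagonal n) (fun kl _ => mul_nonneg (hr _) (hq _))
    (a := (n, 0)) (by simp)
  simpa [hq0] using this

theorem summable_norm_mul_pow {u : ℕ → ℝ} (hu : ∀ n, |u n| ≤ 1) {z : ℂ} (hz : ‖z‖ < 1) :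
    Summable fun n => ‖(u n : ℂ) * z ^ n‖ := by
  refine Summable.of_nonneg_of_le (fun _ => norm_nonneg _) (fun n => ?_)
    (summable_geometric_of_lt_one (norm_nonneg z) hz)
  rw [norm_mul, norm_pow, Complex.norm_real, Real.norm_eq_abs]
  exact mul_le_of_le_one_left (by positivity) (hu n)

theorem tsum_mul_tsum_eq_of_cauchy {r q p : ℕ → ℝ}
    (h : ∀ n, ∑ kl ∈ Finset.HasAntidiagonal.antidiagonal n, r kl.1 * q kl.2 = p n) {z : ℂ}
    (hr : Summable fun n => ‖(r n : ℂ) * z ^ n‖) (hq : Summable fun n => ‖(q n : ℂ) * z ^ n‖) :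
    (∑' n, (r n : ℂ) * z ^ n) * (∑' n, (q n : ℂ) * z ^ n) = ∑' n, (p n : ℂ) * z ^ n := by
  rw [tsum_mul_tsum_eq_tsum_sum_antidiagonal_of_summable_norm hr hq]
  refine tsum_congr fun n => ?_
  rw [← h n, Complex.ofReal_sum, Finset.sum_mul]
  refine Finset.sum_congr rfl fun kl hkl => ?_
  rw [← Finset.HasAntidiagonal.mem_antidiagonal.1 hkl, pow_add]
  push_cast
  ring

/-- If `q` is log-convex and `p / q` is decreasing, then the quotient of the generating
functions takes values in the unit disc about `1`. -/
theorem exists_eq_one_sub_mul {p q : ℕ → ℝ} (hq0 : q 0 = 1) (hq : ∀ n, 0 < q n)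
    (hq1 : ∀ n, q n ≤ 1) (hlc : Monotone fun n => q (n + 1) / q n) (hp0 : p 0 = 1)
    (hp : ∀ n, 0 ≤ p n) (hpq : ∀ n, p (n + 1) * q n ≤ p n * q (n + 1)) {z : ℂ} (hz : ‖z‖ < 1) :
    ∃ u : ℂ, ‖u‖ < 1 ∧
      ∑' n, (p n : ℂ) * z ^ n = (1 - u) * ∑' n, (q n : ℂ) * z ^ n := by
  have hple : ∀ n, p n ≤ q n := by
    intro n
    induction n with
    | zero => rw [hp0, hq0]
    | succ n ih =>
      have h1 := hpq n
      have h2 : p n * q (n + 1) ≤ q n * q (n + 1) := mul_le_mul_of_nonneg_right ih (hq _).le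
      have h3 : p (n + 1) * q n ≤ q (n + 1) * q n := by linarith
      exact le_of_mul_le_mul_right h3 (hq n)
  -- `(q - p) / q = 1 - p / q` is increasing, so `u = (Q - P) / Q` has nonnegative coefficients.
  obtain ⟨r, hr, hconv⟩ := exists_nonneg_cauchy_quotient (p := fun n => q n - p n) hq0 hq hlc
    (by simp [hp0, hq0]) (fun n => by linarith [hpq n])
  have hr1 : ∀ n, |r n| ≤ 1 := fun n => by
    rw [abs_of_nonneg (hr n)]
    have := le_of_cauchy_product hr hq0 (fun n => (hq n).le) n
    rw [hconv] at this
    linarith [hp n, hq1 n]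
  have hqa : ∀ n, |q n| ≤ 1 := fun n => by rw [abs_of_pos (hq n)]; exact hq1 n
  have hpa : ∀ n, |p n| ≤ 1 := fun n => by
    rw [abs_of_nonneg (hp n)]; exact (hple n).trans (hq1 n)
  have key : ∀ w : ℂ, ‖w‖ < 1 → ∑' n, (p n : ℂ) * w ^ n =
      (1 - ∑' n, (r n : ℂ) * w ^ n) * ∑' n, (q n : ℂ) * w ^ n := by
    intro w hw
    have h := tsum_mul_tsum_eq_of_cauchy hconv (summable_norm_mul_pow hr1 hw)
      (summable_norm_mul_pow hqa hw)
    rw [sub_mul, one_mul, h, ← (summable_norm_mul_pow hqa hw).of_norm.tsum_sub]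
    · refine tsum_congr fun n => ?_
      push_cast
      ring
    · refine (summable_norm_mul_pow (u := fun n => q n - p n) (fun n => ?_) hw).of_norm
      rw [abs_of_nonneg (by linarith [hple n])]
      linarith [hp n, hq1 n]
  refine ⟨_, ?_, key z hz⟩
  set x := ‖z‖ with hx
  have hx0 : 0 ≤ x := norm_nonneg z
  have hxn : ‖(x : ℂ)‖ < 1 := by simpa [abs_of_nonneg hx0] using hz
  have hreal : ∀ u : ℕ → ℝ, ∑' n, (u n : ℂ) * (x : ℂ) ^ n = ((∑' n, u n * x ^ n : ℝ) : ℂ) := by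
    intro u
    push_cast
    rfl
  have hsum : ∀ u : ℕ → ℝ, (∀ n, |u n| ≤ 1) → Summable fun n => u n * x ^ n := by
    intro u hu
    have := (summable_norm_mul_pow hu hxn).of_norm
    exact_mod_cast this
  have hpos : ∀ u : ℕ → ℝ, (∀ n, |u n| ≤ 1) → (∀ n, 0 ≤ u n) → u 0 = 1 →
      0 < ∑' n, u n * x ^ n := fun u hu hu0 hu1 =>
    (hsum u hu).tsum_pos (fun n => mul_nonneg (hu0 n) (pow_nonneg hx0 n)) 0 (by simp [hu1])
  -- Nonnegative coefficients give `|u(z)| ≤ u(|z|)`, and at the real point `x = |z|` the identity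
  -- `1 - u = P / Q > 0` yields `u(x) < 1`.
  have hk := key x hxn
  rw [hreal, hreal, hreal] at hk
  norm_cast at hk
  have hP := hpos p hpa hp hp0
  have hQ := hpos q hqa (fun n => (hq n).le) hq0
  rw [hk] at hP
  have hlt : ∑' n, r n * x ^ n < 1 := by
    have := pos_of_mul_pos_left hP hQ.le
    linarith
  refine lt_of_le_of_lt (norm_tsum_le_tsum_norm (summable_norm_mul_pow hr1 hz)) ?_
  refine lt_of_eq_of_lt (tsum_congr fun n => ?_) hlt
  rw [norm_mul, norm_pow, Complex.norm_real, Real.norm_of_nonneg (hr n)]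

/-- If `q` is log-convex and `p / q` is increasing, then the quotient of the generating
functions is bounded on the unit disc by its value at `1`. -/
theorem norm_tsum_le_of_quotient_mono {p q : ℕ → ℝ} (hq0 : q 0 = 1) (hq : ∀ n, 0 < q n)
    (hlc : Monotone fun n => q (n + 1) / q n) (hp0 : 0 ≤ p 0)
    (hpq : ∀ n, p n * q (n + 1) ≤ p (n + 1) * q n) (hps : Summable p) (hqs : Summable q)
    {z : ℂ} (hz : ‖z‖ ≤ 1) :
    ‖∑' n, (p n : ℂ) * z ^ n‖ * ∑' n, q n ≤ (∑' n, p n) * ‖∑' n, (q n : ℂ) * z ^ n‖ := by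
  obtain ⟨r, hr, hconv⟩ := exists_nonneg_cauchy_quotient hq0 hq hlc hp0 hpq
  have hrs : Summable r := hps.of_nonneg_of_le hr fun n => by
    rw [← hconv]
    exact le_of_cauchy_product hr hq0 (fun n => (hq n).le) n
  have hle : ∀ u : ℕ → ℝ, (∀ n, 0 ≤ u n) → ∀ n, ‖(u n : ℂ) * z ^ n‖ ≤ u n := by
    intro u hu n
    rw [norm_mul, norm_pow, Complex.norm_real, Real.norm_of_nonneg (hu n)]
    exact mul_le_of_le_one_right (hu n) (pow_le_one₀ (norm_nonneg z) hz)
  have hrz := hrs.of_nonneg_of_le (fun _ => norm_nonneg _) (hle r hr)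
  have hqz := hqs.of_nonneg_of_le (fun _ => norm_nonneg _) (hle q fun n => (hq n).le)
  have h1 : (∑' n, r n) * ∑' n, q n = ∑' n, p n := by
    rw [tsum_mul_tsum_eq_tsum_sum_antidiagonal_of_summable_norm hrs.norm hqs.norm]
    exact tsum_congr hconv
  rw [← tsum_mul_tsum_eq_of_cauchy hconv hrz hqz, ← h1, norm_mul]
  have h2 : ‖∑' n, (r n : ℂ) * z ^ n‖ ≤ ∑' n, r n :=
    (norm_tsum_le_tsum_norm hrz).trans (hrz.tsum_le_tsum (hle r hr) hrs)
  have h3 : 0 ≤ ∑' n, q n := tsum_nonneg fun n => (hq n).le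
  calc _ = ‖∑' n, (r n : ℂ) * z ^ n‖ * (‖∑' n, (q n : ℂ) * z ^ n‖ * ∑' n, q n) := by ring
    _ ≤ (∑' n, r n) * (‖∑' n, (q n : ℂ) * z ^ n‖ * ∑' n, q n) :=
        mul_le_mul_of_nonneg_right h2 (by positivity)
    _ = _ := by ring

/-! ### Comparison estimates and derivative of polylogarithms -/

/-- The function `Li_s(z) / z = ∑ (n + 1) ^ (-s) z ^ n`. -/
noncomputable def polylogQuot (s : ℝ) (z : ℂ) : ℂ :=
  ∑' n : ℕ, (((n + 1 : ℝ) ^ (-s) : ℝ) : ℂ) * z ^ n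

theorem polylog_eq_mul (s : ℝ) (z : ℂ) : polylog s z = z * polylogQuot s z := by
  rw [polylog, polylogQuot, ← tsum_mul_left]
  refine tsum_congr fun n => ?_
  rw [Real.rpow_neg (by positivity), pow_succ]
  push_cast
  ring

theorem monotone_ratio_rpow_neg {s : ℝ} (hs : 0 ≤ s) :
    Monotone fun n : ℕ => (((n + 1 : ℕ) : ℝ) + 1) ^ (-s) / ((n : ℝ) + 1) ^ (-s) := by
  intro m n hmn
  have hmn' : (m : ℝ) ≤ n := by exact_mod_cast hmn
  simp only
  rw [← Real.div_rpow (by positivity) (by positivity),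
    ← Real.div_rpow (by positivity) (by positivity)]
  refine Real.rpow_le_rpow_of_nonpos (by positivity) ?_ (by linarith)
  push_cast
  rw [div_le_div_iff₀ (by positivity) (by positivity)]
  nlinarith

theorem rpow_neg_mul_rpow_neg_le {a b x y : ℝ} (hab : a ≤ b) (hx : 0 < x) (hxy : x ≤ y) :
    y ^ (-b) * x ^ (-a) ≤ x ^ (-b) * y ^ (-a) := by
  have hy := hx.trans_le hxy
  have h : y ^ (-(b - a)) ≤ x ^ (-(b - a)) :=
    Real.rpow_le_rpow_of_nonpos hx hxy (by linarith)
  have e : ∀ w : ℝ, 0 < w → w ^ (-b) = w ^ (-(b - a)) * w ^ (-a) := fun w hw => by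
    rw [← Real.rpow_add hw]; ring_nf
  rw [e x hx, e y hy]
  have := mul_le_mul_of_nonneg_right h
    (mul_nonneg (Real.rpow_nonneg hx.le (-a)) (Real.rpow_nonneg hy.le (-a)))
  nlinarith [this]

theorem exists_polylogQuot_eq {a b : ℝ} (ha : 0 ≤ a) (hab : a ≤ b) {z : ℂ} (hz : ‖z‖ < 1) :
    ∃ u : ℂ, ‖u‖ < 1 ∧ polylogQuot b z = (1 - u) * polylogQuot a z :=
  exists_eq_one_sub_mul (p := fun n : ℕ => ((n : ℝ) + 1) ^ (-b))
    (q := fun n : ℕ => ((n : ℝ) + 1) ^ (-a)) (by simp) (fun n => by positivity)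
    (fun n => Real.rpow_le_one_of_one_le_of_nonpos
      (by linarith [(Nat.cast_nonneg n : (0 : ℝ) ≤ n)]) (by linarith))
    (monotone_ratio_rpow_neg ha) (by simp) (fun n => by positivity)
    (fun n => rpow_neg_mul_rpow_neg_le hab (by positivity) (by push_cast; linarith)) hz

theorem re_one_sub_pos {u : ℂ} (hu : ‖u‖ < 1) : 0 < (1 - u).re := by
  have := (Complex.re_le_norm u).trans_lt hu
  simpa using this

theorem norm_polylogQuot_le_two_mul {a b : ℝ} (ha : 0 ≤ a) (hab : a ≤ b) {z : ℂ}
    (hz : ‖z‖ < 1) : ‖polylogQuot b z‖ ≤ 2 * ‖polylogQuot a z‖ := by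
  obtain ⟨u, hu, h⟩ := exists_polylogQuot_eq ha hab hz
  rw [h, norm_mul]
  refine mul_le_mul_of_nonneg_right ((norm_sub_le _ _).trans ?_) (norm_nonneg _)
  rw [norm_one]
  linarith

theorem polylogQuot_re_pos {a : ℝ} (ha : 0 ≤ a) {z : ℂ} (hz : ‖z‖ < 1) :
    0 < (polylogQuot a z).re := by
  -- With `P = 1` the comparison reads `1 = (1 - u) Q_a`, so `Q_a` is the inverse of a number with
  -- positive real part.
  obtain ⟨u, hu, h⟩ := exists_eq_one_sub_mul (p := fun n : ℕ => if n = 0 then (1 : ℝ) else 0)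
    (q := fun n : ℕ => ((n : ℝ) + 1) ^ (-a)) (by simp) (fun n => by positivity)
    (fun n => Real.rpow_le_one_of_one_le_of_nonpos
      (by linarith [(Nat.cast_nonneg n : (0 : ℝ) ≤ n)]) (by linarith))
    (monotone_ratio_rpow_neg ha) (by simp) (fun n => by split_ifs <;> norm_num)
    (fun n => by simp only [Nat.succ_ne_zero, if_false, zero_mul]; positivity) hz
  rw [tsum_eq_single 0 (fun n hn => by simp [hn])] at h
  change _ = (1 - u) * polylogQuot a z at h
  have hu' := re_one_sub_pos hu
  have hne : (1 - u) ≠ 0 := fun h0 => by simp [h0] at hu'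
  have h1 : polylogQuot a z = (1 - u)⁻¹ := eq_inv_of_mul_eq_one_right (by simpa using h.symm)
  rw [h1, Complex.inv_re]
  exact div_pos hu' (Complex.normSq_pos.2 hne)

theorem polylogQuot_ne_zero {a : ℝ} (ha : 0 ≤ a) {z : ℂ} (hz : ‖z‖ < 1) :
    polylogQuot a z ≠ 0 := fun h => by
  have := polylogQuot_re_pos ha hz
  simp [h] at this

theorem summable_rpow_neg {b : ℝ} (hb : 1 < b) : Summable fun n : ℕ => ((n : ℝ) + 1) ^ (-b) := by
  have := (summable_nat_add_iff 1).2 (Real.summable_nat_rpow.2 (by linarith : -b < -1))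
  simpa using this

theorem riemannZeta_re_eq_tsum {b : ℝ} (hb : 1 < b) :
    (riemannZeta (b : ℂ)).re = ∑' n : ℕ, ((n : ℝ) + 1) ^ (-b) := by
  rw [zeta_eq_tsum_one_div_nat_add_one_cpow (by simpa using hb)]
  have : ∀ n : ℕ, 1 / ((n : ℂ) + 1) ^ (b : ℂ) = ((((n : ℝ) + 1) ^ (-b) : ℝ) : ℂ) := by
    intro n
    rw [Complex.ofReal_cpow (by positivity)]
    push_cast
    rw [Complex.cpow_neg, one_div]
  simp_rw [this]
  rw [← Complex.ofReal_tsum, Complex.ofReal_re]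

theorem riemannZeta_re_pos {b : ℝ} (hb : 1 < b) : 0 < (riemannZeta (b : ℂ)).re := by
  rw [riemannZeta_re_eq_tsum hb]
  exact (summable_rpow_neg hb).tsum_pos (fun n => by positivity) 0 (by simp)

theorem norm_polylogQuot_mul_zeta_le {a b : ℝ} (hb : 1 < b) (hba : b ≤ a) {z : ℂ}
    (hz : ‖z‖ ≤ 1) : ‖polylogQuot b z‖ * (riemannZeta (a : ℂ)).re ≤
      (riemannZeta (b : ℂ)).re * ‖polylogQuot a z‖ := by
  rw [riemannZeta_re_eq_tsum hb, riemannZeta_re_eq_tsum (hb.trans_le hba)]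
  refine norm_tsum_le_of_quotient_mono (p := fun n : ℕ => ((n : ℝ) + 1) ^ (-b))
    (q := fun n : ℕ => ((n : ℝ) + 1) ^ (-a)) (by simp) (fun n => by positivity)
    (monotone_ratio_rpow_neg (by linarith)) (by simp) (fun n => ?_)
    (summable_rpow_neg hb) (summable_rpow_neg (hb.trans_le hba)) hz
  have := rpow_neg_mul_rpow_neg_le hba (x := (n : ℝ) + 1) (y := ((n + 1 : ℕ) : ℝ) + 1)
    (by positivity) (by push_cast; linarith)
  linarith

theorem rpow_neg_le_self {s x : ℝ} (hs : -1 ≤ s) (hx : 1 ≤ x) : x ^ (-s) ≤ x :=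
  (Real.rpow_le_rpow_of_exponent_le hx (by linarith : -s ≤ 1)).trans_eq (Real.rpow_one x)

theorem summable_natCast_add_one_mul_pow {x : ℝ} (hx0 : 0 ≤ x) (hx : x < 1) :
    Summable fun n : ℕ => ((n : ℝ) + 1) * x ^ n := by
  have h1 := summable_pow_mul_geometric_of_norm_lt_one 1
    (by rwa [Real.norm_of_nonneg hx0] : ‖x‖ < 1)
  have h2 := summable_geometric_of_lt_one hx0 hx
  refine (h1.add h2).congr fun n => ?_
  ring

theorem summable_polylogQuot {s : ℝ} (hs : -1 ≤ s) {z : ℂ} (hz : ‖z‖ < 1) :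
    Summable fun n : ℕ => (((n + 1 : ℝ) ^ (-s) : ℝ) : ℂ) * z ^ n := by
  refine Summable.of_norm_bounded
    (summable_natCast_add_one_mul_pow (norm_nonneg z) hz) fun n => ?_
  rw [norm_mul, norm_pow, Complex.norm_real, Real.norm_of_nonneg (by positivity)]
  exact mul_le_mul_of_nonneg_right
    (rpow_neg_le_self hs (by linarith [(Nat.cast_nonneg n : (0 : ℝ) ≤ n)])) (by positivity)

theorem hasDerivAt_polylog {s : ℝ} (hs : 0 ≤ s) {z : ℂ} (hz : ‖z‖ < 1) :
    HasDerivAt (polylog s) (polylogQuot (s - 1) z) z := by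
  -- On the smaller disc of radius `ρ` the differentiated terms are dominated by `(n + 1) ρ ^ n`;
  -- this uses `s - 1 ≥ -1`.
  obtain ⟨ρ, hzρ, hρ⟩ := exists_between hz
  have hρ0 : 0 < ρ := (norm_nonneg z).trans_lt hzρ
  unfold polylog polylogQuot
  refine hasDerivAt_tsum_of_isPreconnected (t := Metric.ball (0 : ℂ) ρ) (y₀ := 0)
    (𝕜 := ℂ) (F := ℂ) (g := fun (n : ℕ) (w : ℂ) => w ^ (n + 1) / (((n + 1 : ℝ) ^ s : ℝ) : ℂ))
    (g' := fun (n : ℕ) (w : ℂ) => (((n + 1 : ℝ) ^ (-(s - 1)) : ℝ) : ℂ) * w ^ n)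
    (summable_natCast_add_one_mul_pow hρ0.le hρ) Metric.isOpen_ball
    (convex_ball (0 : ℂ) ρ).isPreconnected ?_ ?_ (Metric.mem_ball_self hρ0) ?_ (by simpa using hzρ)
  · intro n y _
    have h := (hasDerivAt_pow (n + 1) y).div_const (((n + 1 : ℝ) ^ s : ℝ) : ℂ)
    refine h.congr_deriv ?_
    rw [show -(s - 1) = 1 - s by ring, Real.rpow_sub (by positivity), Real.rpow_one]
    push_cast
    ring
  · intro n y hy
    rw [mem_ball_zero_iff] at hy
    rw [norm_mul, norm_pow, Complex.norm_real, Real.norm_of_nonneg (by positivity)]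
    gcongr
    exact rpow_neg_le_self (by linarith) (by linarith [(Nat.cast_nonneg n : (0 : ℝ) ≤ n)])
  · refine summable_zero.congr fun n => ?_
    simp

/-! ### Lipschitz bound from supporting lines -/

open Filter Topology in
/-- Moving `a` so that `h a` moves straight towards `h b` increases `‖g a - g b‖ - k' ‖h a - h b‖`
as long as `‖g'‖ ≤ k ‖h'‖` with `k < k'`. -/
theorem exists_norm_sub_gap_lt {h g : ℂ → ℂ} {a b h' g' : ℂ} {r k k' : ℝ} (hk : 0 ≤ k)
    (hkk : k < k') (ha : ‖a‖ ≤ r) (hh : HasDerivAt h h' a) (hg : HasDerivAt g g' a) (hne : h' ≠ 0)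
    (hle : ‖g'‖ ≤ k * ‖h'‖) (hab : h a ≠ h b)
    (hdir : ‖a‖ < r ∨ 0 < ((h a - h b) * (starRingEnd ℂ) (a * h')).re) :
    ∃ w, ‖w‖ ≤ r ∧
      ‖g a - g b‖ - k' * ‖h a - h b‖ < ‖g w - g b‖ - k' * ‖h w - h b‖ := by
  set D := ‖h a - h b‖ with hD
  have hD0 : 0 < D := norm_pos_iff.2 (sub_ne_zero.2 hab)
  -- The direction that moves `h a` straight towards `h b` at speed `D`.
  set v := -(h a - h b) / h' with hv
  have hhv : h' * v = -(h a - h b) := by rw [hv]; field_simp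
  have hgv : ‖g' * v‖ ≤ k * D := by
    calc ‖g' * v‖ = ‖g'‖ * ‖v‖ := norm_mul _ _
      _ ≤ k * ‖h'‖ * ‖v‖ := mul_le_mul_of_nonneg_right hle (norm_nonneg v)
      _ = k * ‖h' * v‖ := by rw [norm_mul]; ring
      _ = k * D := by rw [hhv, norm_neg]
  -- The first-order gain per unit time is at least `(k' - k) D`. The errors in `g` and `h` cost `(1
  -- + k') ε`, half of that gain.
  set ε := (k' - k) * D / (2 * (1 + k')) with hε
  have hk' : 0 < 1 + k' := by linarith
  have hε0 : 0 < ε := div_pos (mul_pos (by linarith) hD0) (by linarith)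
  have hεe : (1 + k') * ε = (k' - k) * D / 2 := by rw [hε]; field_simp
  have hline : HasDerivAt (fun s : ℝ => a + (s : ℂ) * v) v 0 := by
    simpa using ((Complex.ofRealCLM.hasDerivAt (x := (0 : ℝ))).mul_const v).const_add a
  have hlo : ∀ {f : ℂ → ℂ} {f' : ℂ}, HasDerivAt f f' a → ∀ᶠ s : ℝ in 𝓝[>] 0,
      ‖f (a + s * v) - f a - s * (f' * v)‖ ≤ ε * s := by
    intro f f' hf
    have h1 : HasDerivAt (fun s : ℝ => f (a + s * v)) (f' * v) 0 :=
      HasDerivAt.comp_of_eq (h₂ := f) 0 hf hline (by simp) |>.congr_deriv rfl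
    have h2 := (hasDerivAt_iff_isLittleO.1 h1).bound hε0
    filter_upwards [nhdsWithin_le_nhds h2, self_mem_nhdsWithin] with s hs hs0
    have hs0' : (0 : ℝ) < s := hs0
    simpa [abs_of_pos hs0'] using hs
  have hin : ∀ᶠ s : ℝ in 𝓝[>] 0, ‖a + (s : ℂ) * v‖ ≤ r := by
    rcases hdir with hlt | hpos
    · have hc : ContinuousAt (fun s : ℝ => ‖a + (s : ℂ) * v‖) 0 := hline.continuousAt.norm
      have := hc.eventually_lt (continuousAt_const (y := r)) (by simpa using hlt)
      exact nhdsWithin_le_nhds (this.mono fun _ => le_of_lt)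
    -- The supporting-line condition says exactly that `v` points into the disc at the boundary
    -- point `a`.
    · have hav : ((starRingEnd ℂ) a * v).re < 0 := by
        have e : (starRingEnd ℂ) a * v =
            -(((h a - h b) * (starRingEnd ℂ) (a * h')) / (Complex.normSq h' : ℂ)) := by
          have hne' : (starRingEnd ℂ) h' ≠ 0 := by simpa using hne
          rw [hv, map_mul, ← Complex.mul_conj]
          field_simp
        rw [e, Complex.neg_re, Complex.div_ofReal_re]
        have := div_pos hpos (Complex.normSq_pos.2 hne)
        linarith
      have hc : ContinuousAt
          (fun s : ℝ => 2 * ((starRingEnd ℂ) a * v).re + s * Complex.normSq v) 0 := by fun_prop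
      have hev := hc.eventually_lt (continuousAt_const (y := (0 : ℝ))) (by
        simp only [zero_mul, add_zero]
        linarith)
      filter_upwards [nhdsWithin_le_nhds hev, self_mem_nhdsWithin] with s hs hs0
      have hs0' : (0 : ℝ) < s := hs0
      refine le_trans ?_ ha
      rw [← sq_le_sq₀ (norm_nonneg _) (norm_nonneg _), ← Complex.normSq_eq_norm_sq,
        ← Complex.normSq_eq_norm_sq]
      have e : Complex.normSq (a + (s : ℂ) * v) = Complex.normSq a +
          s * (2 * ((starRingEnd ℂ) a * v).re + s * Complex.normSq v) := by
        simp [Complex.normSq_apply]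
        ring
      rw [e]
      nlinarith [mul_pos hs0' (neg_pos.2 hs)]
  have hone : ∀ᶠ s : ℝ in 𝓝[>] 0, s < 1 :=
    nhdsWithin_le_nhds (eventually_lt_nhds one_pos)
  obtain ⟨s, hs1, hs2, hs3, hs4, hs0⟩ :=
    ((hlo hh).and ((hlo hg).and (hin.and (hone.and self_mem_nhdsWithin)))).exists
  have hs0' : (0 : ℝ) < s := hs0
  refine ⟨_, hs3, ?_⟩
  set w := a + (s : ℂ) * v
  have hH : ‖h w - h b‖ ≤ (1 - s) * D + ε * s := by
    have e : h w - h b = ((1 - s : ℝ) : ℂ) * (h a - h b) + (h w - h a - s * (h' * v)) := by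
      rw [hhv]; push_cast; ring
    rw [e]
    refine (norm_add_le _ _).trans (add_le_add (le_of_eq ?_) hs1)
    rw [norm_mul, Complex.norm_real, Real.norm_of_nonneg (by linarith)]
  have hG : ‖g a - g b‖ ≤ ‖g w - g b‖ + (s * (k * D) + ε * s) := by
    have e : g a - g b = (g w - g b) - (s * (g' * v) + (g w - g a - s * (g' * v))) := by ring
    rw [e]
    refine (norm_sub_le _ _).trans (add_le_add le_rfl ((norm_add_le _ _).trans
      (add_le_add ?_ hs2)))
    rw [norm_mul, Complex.norm_real, Real.norm_of_nonneg hs0'.le]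
    exact mul_le_mul_of_nonneg_left hgv hs0'.le
  have h1 := mul_le_mul_of_nonneg_left hH (by linarith : 0 ≤ k')
  have h2 : 0 < s * ((k' - k) * D / 2) :=
    mul_pos hs0' (half_pos (mul_pos (by linarith) hD0))
  have h3 : s * ((1 + k') * ε) = s * ((k' - k) * D / 2) := by rw [hεe]
  nlinarith

/-- If `h` maps the circle of radius `r` onto a curve with supporting lines and `|g'| ≤ k |h'|`,
then `g ∘ h⁻¹` is `k'`-Lipschitz for every `k' > k`. -/
theorem norm_sub_le_of_supporting {h g h' g' : ℂ → ℂ} {r k k' : ℝ} (hk : 0 ≤ k) (hkk : k < k')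
    (hh : ∀ z, ‖z‖ ≤ r → HasDerivAt h (h' z) z) (hg : ∀ z, ‖z‖ ≤ r → HasDerivAt g (g' z) z)
    (hne : ∀ z, ‖z‖ ≤ r → h' z ≠ 0) (hle : ∀ z, ‖z‖ ≤ r → ‖g' z‖ ≤ k * ‖h' z‖)
    (hinj : Set.InjOn h (Metric.closedBall 0 r))
    (hsupp : ∀ a b, ‖a‖ = r → ‖b‖ = r → a ≠ b →
      0 < ((h a - h b) * (starRingEnd ℂ) (a * h' a)).re)
    {x y : ℂ} (hx : ‖x‖ ≤ r) (hy : ‖y‖ ≤ r) : ‖g x - g y‖ ≤ k' * ‖h x - h y‖ := by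
  have hK : IsCompact (Metric.closedBall (0 : ℂ) r ×ˢ Metric.closedBall (0 : ℂ) r) :=
    (isCompact_closedBall 0 r).prod (isCompact_closedBall 0 r)
  have hhc : ContinuousOn h (Metric.closedBall 0 r) := fun z hz =>
    (hh z (by simpa using hz)).continuousAt.continuousWithinAt
  have hgc : ContinuousOn g (Metric.closedBall 0 r) := fun z hz =>
    (hg z (by simpa using hz)).continuousAt.continuousWithinAt
  have hΨ : ContinuousOn (fun p : ℂ × ℂ => ‖g p.1 - g p.2‖ - k' * ‖h p.1 - h p.2‖)
      (Metric.closedBall (0 : ℂ) r ×ˢ Metric.closedBall (0 : ℂ) r) := by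
    have m1 : Set.MapsTo Prod.fst (Metric.closedBall (0 : ℂ) r ×ˢ Metric.closedBall (0 : ℂ) r)
      (Metric.closedBall (0 : ℂ) r) := fun p hp => hp.1
    have m2 : Set.MapsTo Prod.snd (Metric.closedBall (0 : ℂ) r ×ˢ Metric.closedBall (0 : ℂ) r)
      (Metric.closedBall (0 : ℂ) r) := fun p hp => hp.2
    exact ((hgc.comp continuousOn_fst m1).sub (hgc.comp continuousOn_snd m2)).norm.sub
      (continuousOn_const.mul
        ((hhc.comp continuousOn_fst m1).sub (hhc.comp continuousOn_snd m2)).norm)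
  obtain ⟨⟨a, b⟩, ⟨ha, hb⟩, hmax⟩ := hK.exists_isMaxOn
    ⟨(x, y), by simpa using hx, by simpa using hy⟩ hΨ
  have hmax' : ∀ p q : ℂ, ‖p‖ ≤ r → ‖q‖ ≤ r →
      ‖g p - g q‖ - k' * ‖h p - h q‖ ≤ ‖g a - g b‖ - k' * ‖h a - h b‖ := fun p q hp hq =>
    hmax (show (p, q) ∈ _ from ⟨by simpa using hp, by simpa using hq⟩)
  simp only [mem_closedBall_zero_iff] at ha hb
  by_contra hcon
  have hpos := hmax' x y hx hy
  have hab : a ≠ b := by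
    rintro rfl
    simp only [sub_self, norm_zero, mul_zero] at hpos
    linarith [not_le.1 hcon]
  have hhab : h a ≠ h b := fun e => hab (hinj (by simpa using ha) (by simpa using hb) e)
  -- A maximal pair with `a ≠ b` can always be improved: move an interior point freely, or, if both
  -- points lie on the circle, move `a` using the supporting line.
  by_cases hb' : ‖b‖ < r
  · obtain ⟨w, hw, hlt⟩ := exists_norm_sub_gap_lt (a := b) (b := a) hk hkk hb (hh b hb) (hg b hb)
      (hne b hb) (hle b hb) hhab.symm (Or.inl hb')
    have := hmax' a w ha hw
    rw [norm_sub_rev (g b), norm_sub_rev (h b), norm_sub_rev (g w), norm_sub_rev (h w)] at hlt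
    linarith
  · obtain ⟨w, hw, hlt⟩ := exists_norm_sub_gap_lt (a := a) (b := b) hk hkk ha (hh a ha) (hg a ha)
      (hne a ha) (hle a ha) hhab ((lt_or_eq_of_le ha).imp_right fun ha' =>
        hsupp a b ha' (le_antisymm hb (not_lt.1 hb')) hab)
    have := hmax' w b hw hb
    linarith

/-! ### Integrals against the kernel `1 / (1 - e^{-x} z)` -/

open MeasureTheory Set in
theorem setIntegral_Ioi_pos {f : ℝ → ℝ} (hf : IntegrableOn f (Ioi 0)) (h : ∀ x, 0 < x → 0 < f x) :
    0 < ∫ x in Ioi 0, f x := by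
  rw [setIntegral_pos_iff_support_of_nonneg_ae _ hf]
  · refine lt_of_lt_of_le ?_ (measure_mono (μ := volume) (s := Ioi 0) fun x hx =>
      ⟨(h x hx).ne', hx⟩)
    simp
  · filter_upwards [ae_restrict_mem measurableSet_Ioi] with x hx using (h x hx).le

/-- The kernel `1 / (1 - e^{-x} z)`. -/
noncomputable def geomKernel (z : ℂ) (x : ℝ) : ℂ := (1 - (Real.exp (-x) : ℂ) * z)⁻¹

theorem norm_exp_mul_lt {z : ℂ} (hz : ‖z‖ < 1) {x : ℝ} (hx : 0 ≤ x) :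
    ‖(Real.exp (-x) : ℂ) * z‖ < 1 := by
  rw [norm_mul, Complex.norm_real, Real.norm_of_nonneg (Real.exp_pos _).le]
  exact lt_of_le_of_lt (mul_le_of_le_one_left (norm_nonneg z) (Real.exp_le_one_iff.2 (by linarith)))
    hz

theorem one_sub_ne_zero_of_norm_lt {z : ℂ} (hz : ‖z‖ < 1) : 1 - z ≠ 0 := fun h => by
  rw [← sub_eq_zero.1 h] at hz
  simp at hz

/-- The numerator is affine in `e^{-x}`, so as a function of `x` it has at most one sign change
unless it vanishes identically. -/
theorem geomKernel_mul_conj_im (z c : ℂ) (x : ℝ) :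
    (geomKernel z x * (starRingEnd ℂ) c).im =
      (Real.exp (-x) * (z.im * c.re + z.re * c.im) - c.im) /
        Complex.normSq (1 - (Real.exp (-x) : ℂ) * z) := by
  rw [geomKernel, Complex.inv_def, mul_right_comm, Complex.im_mul_ofReal, div_eq_mul_inv]
  congr 1
  simp [-Complex.ofReal_exp]
  ring

theorem geomKernel_im_nonneg {z : ℂ} (hz : 0 ≤ z.im) (x : ℝ) : 0 ≤ (geomKernel z x).im := by
  have := geomKernel_mul_conj_im z 1 x
  simp only [map_one, mul_one, Complex.one_re, Complex.one_im, mul_zero, add_zero, sub_zero] at this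
  rw [this]
  exact div_nonneg (mul_nonneg (Real.exp_pos _).le hz) (Complex.normSq_nonneg _)

theorem geomKernel_im_pos {z : ℂ} (hz : ‖z‖ < 1) (hzi : 0 < z.im) {x : ℝ} (hx : 0 ≤ x) :
    0 < (geomKernel z x).im := by
  have := geomKernel_mul_conj_im z 1 x
  simp only [map_one, mul_one, Complex.one_re, Complex.one_im, mul_zero, add_zero, sub_zero] at this
  rw [this]
  exact div_pos (mul_pos (Real.exp_pos _) hzi)
    (Complex.normSq_pos.2 (one_sub_ne_zero_of_norm_lt (norm_exp_mul_lt hz hx)))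

theorem geomKernel_re_pos {z : ℂ} (hz : ‖z‖ < 1) {x : ℝ} (hx : 0 ≤ x) :
    0 < (geomKernel z x).re := by
  rw [geomKernel, Complex.inv_re]
  exact div_pos (re_one_sub_pos (norm_exp_mul_lt hz hx))
    (Complex.normSq_pos.2 (one_sub_ne_zero_of_norm_lt (norm_exp_mul_lt hz hx)))

open MeasureTheory Set in
theorem integrableOn_mul_geomKernel {w : ℝ → ℝ} (hw : IntegrableOn w (Ioi 0)) {z : ℂ}
    (hz : ‖z‖ < 1) : IntegrableOn (fun x => (w x : ℂ) * geomKernel z x) (Ioi 0) := by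
  refine Integrable.mul_bdd (c := (1 - ‖z‖)⁻¹) hw.ofReal ?_ ?_
  · refine ContinuousOn.aestronglyMeasurable (fun x hx => ?_) measurableSet_Ioi
    refine ContinuousAt.continuousWithinAt (ContinuousAt.inv₀ (by fun_prop) ?_)
    exact one_sub_ne_zero_of_norm_lt (norm_exp_mul_lt hz (le_of_lt hx))
  · filter_upwards [ae_restrict_mem measurableSet_Ioi] with x hx
    rw [geomKernel, norm_inv]
    refine inv_anti₀ (by linarith) ?_
    have h1 : ‖(Real.exp (-x) : ℂ) * z‖ ≤ ‖z‖ := by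
      rw [norm_mul, Complex.norm_real, Real.norm_of_nonneg (Real.exp_pos _).le]
      exact mul_le_of_le_one_left (norm_nonneg z)
        (Real.exp_le_one_iff.2 (by linarith [show (0 : ℝ) < x from hx]))
    have h2 := norm_sub_norm_le (1 : ℂ) ((Real.exp (-x) : ℂ) * z)
    rw [norm_one] at h2
    linarith

open MeasureTheory Set in
theorem setIntegral_mul_conj_im {w : ℝ → ℝ} (hw : IntegrableOn w (Ioi 0)) {z : ℂ}
    (hz : ‖z‖ < 1) (c : ℂ) :
    IntegrableOn (fun x => w x * (geomKernel z x * (starRingEnd ℂ) c).im) (Ioi 0) ∧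
    ((∫ x in Ioi 0, (w x : ℂ) * geomKernel z x) * (starRingEnd ℂ) c).im =
      ∫ x in Ioi 0, w x * (geomKernel z x * (starRingEnd ℂ) c).im := by
  have hi := (integrableOn_mul_geomKernel hw hz).mul_const ((starRingEnd ℂ) c)
  have e : ∀ x, w x * (geomKernel z x * (starRingEnd ℂ) c).im =
      Complex.imCLM ((w x : ℂ) * geomKernel z x * (starRingEnd ℂ) c) := fun x => by
    rw [mul_assoc, Complex.imCLM_apply, Complex.im_ofReal_mul]
  simp_rw [e]
  refine ⟨Complex.imCLM.integrable_comp hi, ?_⟩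
  rw [Complex.imCLM.integral_comp_comm hi, integral_mul_const, Complex.imCLM_apply]

open MeasureTheory Set in
theorem setIntegral_geomKernel_re_pos {w : ℝ → ℝ} (hw : IntegrableOn w (Ioi 0))
    (hw0 : ∀ x, 0 < x → 0 < w x) {z : ℂ} (hz : ‖z‖ < 1) :
    0 < (∫ x in Ioi 0, (w x : ℂ) * geomKernel z x).re := by
  have hi := integrableOn_mul_geomKernel hw hz
  have h := setIntegral_Ioi_pos (Complex.reCLM.integrable_comp hi) fun x hx => by
    rw [Complex.reCLM_apply, Complex.re_ofReal_mul]
    exact mul_pos (hw0 x hx) (geomKernel_re_pos hz hx.le)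
  rwa [Complex.reCLM.integral_comp_comm hi] at h

open MeasureTheory Set in
theorem setIntegral_geomKernel_im_nonneg {w : ℝ → ℝ} (hw : IntegrableOn w (Ioi 0))
    (hw0 : ∀ x, 0 < x → 0 < w x) {z : ℂ} (hz : ‖z‖ < 1) (hzi : 0 ≤ z.im) :
    0 ≤ (∫ x in Ioi 0, (w x : ℂ) * geomKernel z x).im := by
  have h := (setIntegral_mul_conj_im hw hz 1).2
  simp only [map_one, mul_one] at h
  rw [h]
  exact setIntegral_nonneg measurableSet_Ioi fun x hx =>
    mul_nonneg (hw0 x hx).le (geomKernel_im_nonneg hzi x)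

open MeasureTheory Set in
theorem setIntegral_geomKernel_im_pos {w : ℝ → ℝ} (hw : IntegrableOn w (Ioi 0))
    (hw0 : ∀ x, 0 < x → 0 < w x) {z : ℂ} (hz : ‖z‖ < 1) (hzi : 0 < z.im) :
    0 < (∫ x in Ioi 0, (w x : ℂ) * geomKernel z x).im := by
  have h := setIntegral_mul_conj_im hw hz 1
  simp only [map_one, mul_one] at h
  rw [h.2]
  exact setIntegral_Ioi_pos h.1 fun x hx => mul_pos (hw0 x hx) (geomKernel_im_pos hz hzi hx.le)

open MeasureTheory Set in
/-- If the weight ratio `v` is increasing, then the quotient of the two Stieltjes-type integrals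
with weights `v * w` and `w` maps the upper half disc to the closed lower half plane. -/
theorem setIntegral_mul_conj_im_nonpos {w v : ℝ → ℝ} (hw : IntegrableOn w (Ioi 0))
    (hvw : IntegrableOn (fun x => v x * w x) (Ioi 0)) (hw0 : ∀ x, 0 < x → 0 < w x)
    (hv0 : ∀ x, 0 < x → 0 < v x) (hv : MonotoneOn v (Ioi 0)) {z : ℂ} (hz : ‖z‖ < 1)
    (hzi : 0 ≤ z.im) :
    ((∫ x in Ioi 0, ((v x * w x : ℝ) : ℂ) * geomKernel z x) *
      (starRingEnd ℂ) (∫ x in Ioi 0, (w x : ℂ) * geomKernel z x)).im ≤ 0 := by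
  set F := ∫ x in Ioi 0, (w x : ℂ) * geomKernel z x with hF
  obtain ⟨hi1, he1⟩ := setIntegral_mul_conj_im hvw hz F
  obtain ⟨hi2, he2⟩ := setIntegral_mul_conj_im hw hz F
  rw [he1]
  have hX : 0 < F.re := setIntegral_geomKernel_re_pos hw hw0 hz
  have hY : 0 ≤ F.im := setIntegral_geomKernel_im_nonneg hw hw0 hz hzi
  set m := z.im * F.re + z.re * F.im with hm
  by_cases hall : ∀ x : ℝ, 0 < x → Real.exp (-x) * m - F.im ≤ 0
  · refine setIntegral_nonpos measurableSet_Ioi fun x hx => ?_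
    refine mul_nonpos_of_nonneg_of_nonpos (mul_pos (hv0 x hx) (hw0 x hx)).le ?_
    rw [geomKernel_mul_conj_im]
    exact div_nonpos_of_nonpos_of_nonneg (hall x hx) (Complex.normSq_nonneg _)
  push Not at hall
  obtain ⟨x₁, hx₁, hpos⟩ := hall
  have hYpos : 0 < F.im := by
    rcases hzi.lt_or_eq with hlt | heq
    · exact setIntegral_geomKernel_im_pos hw hw0 hz hlt
    · rcases hY.lt_or_eq with h | h
      · exact h
      · rw [hm, ← h, ← heq] at hpos
        simp at hpos
  have hmpos : 0 < m := pos_of_mul_pos_right (by linarith) (Real.exp_pos (-x₁)).le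
  have hYm : F.im < m := by
    have : Real.exp (-x₁) * m ≤ m :=
      mul_le_of_le_one_left hmpos.le (Real.exp_le_one_iff.2 (by linarith))
    linarith
  -- The unique sign change of `Im (K conj F)`, where `K` is the kernel: nonnegative before `x₀`,
  -- nonpositive after.
  set x₀ := -Real.log (F.im / m) with hx₀
  have hx₀pos : 0 < x₀ := by
    have := Real.log_neg (div_pos hYpos hmpos) ((div_lt_one hmpos).2 hYm)
    linarith
  have hex : Real.exp (-x₀) * m = F.im := by
    rw [hx₀, neg_neg, Real.exp_log (div_pos hYpos hmpos)]
    field_simp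
  have hzero : ∫ x in Ioi 0, w x * (geomKernel z x * (starRingEnd ℂ) F).im = 0 := by
    rw [← he2, Complex.mul_conj, Complex.ofReal_im]
  -- Chebyshev-type comparison: replacing the increasing `v` by the constant `v x₀` can only
  -- increase the integral, and the constant weight gives `v x₀ * Im (F conj F) = 0`.
  have hle : ∫ x in Ioi 0, (v x * w x) * (geomKernel z x * (starRingEnd ℂ) F).im ≤
      ∫ x in Ioi 0, v x₀ * (w x * (geomKernel z x * (starRingEnd ℂ) F).im) := by
    refine setIntegral_mono_on hi1 (hi2.const_mul _) measurableSet_Ioi fun x hx => ?_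
    rw [mul_assoc, geomKernel_mul_conj_im, ← hm]
    set N := Complex.normSq (1 - (Real.exp (-x) : ℂ) * z)
    have hN : 0 ≤ N := Complex.normSq_nonneg _
    have hwx := hw0 x hx
    have key : (v x - v x₀) * (Real.exp (-x) * m - F.im) ≤ 0 := by
      rcases le_total x x₀ with h | h
      · refine mul_nonpos_of_nonpos_of_nonneg (sub_nonpos.2 (hv hx hx₀pos h)) ?_
        rw [← hex, ← sub_mul]
        exact mul_nonneg (sub_nonneg.2 (Real.exp_le_exp.2 (by linarith))) hmpos.le
      · refine mul_nonpos_of_nonneg_of_nonpos (sub_nonneg.2 (hv hx₀pos hx h)) ?_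
        rw [← hex, ← sub_mul]
        exact mul_nonpos_of_nonpos_of_nonneg
          (sub_nonpos.2 (Real.exp_le_exp.2 (by linarith))) hmpos.le
    have h2 : (v x - v x₀) * (Real.exp (-x) * m - F.im) * (w x / N) ≤ 0 :=
      mul_nonpos_of_nonpos_of_nonneg key (div_nonneg hwx.le hN)
    have e : (v x - v x₀) * (Real.exp (-x) * m - F.im) * (w x / N) =
      v x * (w x * ((Real.exp (-x) * m - F.im) / N)) -
        v x₀ * (w x * ((Real.exp (-x) * m - F.im) / N)) := by ring
    linarith
  rw [integral_const_mul, hzero, mul_zero] at hle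
  exact hle

/-! ### Integral representations of `Q_s` -/

open MeasureTheory Set in
theorem mul_polylogQuot_eq_setIntegral {φ : ℕ → ℝ → ℝ} {C s : ℝ} (hs : -1 ≤ s)
    (hφ : ∀ n, IntegrableOn (φ n) (Ioi 0)) (hφ0 : ∀ n x, 0 < x → 0 ≤ φ n x)
    (hint : ∀ n : ℕ, ∫ x in Ioi 0, φ n x = C * ((n : ℝ) + 1) ^ (-s)) {z : ℂ} (hz : ‖z‖ < 1) :
    (C : ℂ) * polylogQuot s z = ∫ x in Ioi 0, ∑' n, (φ n x : ℂ) * z ^ n := by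
  have hnorm : ∀ n : ℕ, ∫ x in Ioi 0, ‖(φ n x : ℂ) * z ^ n‖ =
      C * (((n : ℝ) + 1) ^ (-s) * ‖z‖ ^ n) := by
    intro n
    rw [← mul_assoc, ← hint, ← integral_mul_const]
    refine setIntegral_congr_fun measurableSet_Ioi fun x hx => ?_
    rw [norm_mul, norm_pow, Complex.norm_real, Real.norm_of_nonneg (hφ0 n x hx)]
  have h := hasSum_integral_of_summable_integral_norm (μ := volume.restrict (Ioi (0 : ℝ)))
    (F := fun n x => (φ n x : ℂ) * z ^ n) (fun n => (hφ n).ofReal.mul_const _) (by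
      simp_rw [hnorm]
      refine Summable.mul_left _ ?_
      refine (summable_polylogQuot hs hz).norm.congr fun n => ?_
      rw [norm_mul, norm_pow, Complex.norm_real, Real.norm_of_nonneg (by positivity)])
  rw [← h.tsum_eq, polylogQuot, ← tsum_mul_left]
  refine tsum_congr fun n => ?_
  rw [integral_mul_const, integral_complex_ofReal, hint]
  push_cast
  ring

open MeasureTheory Set in
theorem integrableOn_rpow_mul_exp_neg_mul {a m : ℝ} (ha : 0 < a) (hm : 0 < m) :
    IntegrableOn (fun x : ℝ => x ^ (a - 1) * Real.exp (-(m * x))) (Ioi 0) := by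
  refine Integrable.of_integral_ne_zero ?_
  rw [Real.integral_rpow_mul_exp_neg_mul_Ioi ha hm]
  have := Real.Gamma_pos_of_pos ha
  positivity

theorem exp_neg_natCast_succ_mul (n : ℕ) (x : ℝ) :
    Real.exp (-(((n : ℝ) + 1) * x)) = Real.exp (-x) * Real.exp (-x) ^ n := by
  rw [← Real.exp_nat_mul, ← Real.exp_add]
  ring_nf

theorem hasSum_exp_neg_mul_pow {z : ℂ} (hz : ‖z‖ < 1) {x : ℝ} (hx : 0 ≤ x) :
    HasSum (fun n : ℕ => (Real.exp (-(((n : ℝ) + 1) * x)) : ℂ) * z ^ n)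
      (Real.exp (-x) * geomKernel z x) := by
  refine ((hasSum_geometric_of_norm_lt_one (norm_exp_mul_lt hz hx)).mul_left
    (Real.exp (-x) : ℂ)).congr_fun fun n => ?_
  rw [exp_neg_natCast_succ_mul, mul_pow]
  push_cast
  ring

open MeasureTheory Set in
theorem Gamma_mul_polylogQuot {a : ℝ} (ha : 0 < a) {z : ℂ} (hz : ‖z‖ < 1) :
    (Real.Gamma a : ℂ) * polylogQuot a z =
      ∫ x in Ioi 0, ((x ^ (a - 1) * Real.exp (-x) : ℝ) : ℂ) * geomKernel z x := by
  rw [mul_polylogQuot_eq_setIntegral (by linarith)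
    (φ := fun n x => x ^ (a - 1) * Real.exp (-(((n : ℝ) + 1) * x)))
    (fun n => integrableOn_rpow_mul_exp_neg_mul ha (by positivity))
    (fun n x hx => by positivity) (fun n => ?_) hz]
  · refine setIntegral_congr_fun measurableSet_Ioi fun x hx => ?_
    have h := ((hasSum_exp_neg_mul_pow hz (le_of_lt hx)).mul_left ((x ^ (a - 1) : ℝ) : ℂ)).tsum_eq
    rw [Complex.ofReal_mul, mul_assoc, ← h]
    refine tsum_congr fun n => ?_
    rw [Complex.ofReal_mul, mul_assoc]
  · rw [Real.integral_rpow_mul_exp_neg_mul_Ioi ha (by positivity), one_div,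
      Real.inv_rpow (by positivity), ← Real.rpow_neg (by positivity), mul_comm]

-- Since `1 - e^{-x}` is at most `x` near 0 and at most 1 at infinity, the integrand is dominated by
-- `x ^ (a - 1)` and `x ^ (a - 2)` respectively.
open MeasureTheory Set in
theorem integrableOn_rpow_mul_one_sub_exp {a : ℝ} (ha : 0 < a) (ha1 : a < 1) :
    IntegrableOn (fun x : ℝ => x ^ (a - 2) * (1 - Real.exp (-x))) (Ioi 0) := by
  have hc : ContinuousOn (fun x : ℝ => x ^ (a - 2) * (1 - Real.exp (-x))) (Ioi 0) := by
    refine ContinuousOn.mul (fun x hx => ?_) (by fun_prop)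
    exact (Real.continuousAt_rpow_const x _ (Or.inl (ne_of_gt hx))).continuousWithinAt
  rw [← Ioc_union_Ioi_eq_Ioi (zero_le_one' ℝ)]
  refine IntegrableOn.union ?_ ?_
  · have hi : IntegrableOn (fun x : ℝ => x ^ (a - 1)) (Ioc 0 1) :=
      (intervalIntegrable_iff_integrableOn_Ioc_of_le zero_le_one).1
        (intervalIntegral.intervalIntegrable_rpow' (by linarith))
    refine Integrable.mono' hi
      ((hc.mono Ioc_subset_Ioi_self).aestronglyMeasurable measurableSet_Ioc) ?_
    filter_upwards [ae_restrict_mem measurableSet_Ioc] with x hx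
    have h0 : 0 ≤ 1 - Real.exp (-x) := sub_nonneg.2 (Real.exp_le_one_iff.2 (by linarith [hx.1]))
    have h1 : 1 - Real.exp (-x) ≤ x := by linarith [Real.add_one_le_exp (-x)]
    have hx0 := hx.1
    rw [Real.norm_of_nonneg (by positivity)]
    calc x ^ (a - 2) * (1 - Real.exp (-x)) ≤ x ^ (a - 2) * x := by gcongr
      _ = x ^ (a - 1) := by
        rw [← Real.rpow_add_one hx0.ne']; ring_nf
  · have hi : IntegrableOn (fun x : ℝ => x ^ (a - 2)) (Ioi 1) :=
      integrableOn_Ioi_rpow_of_lt (by linarith) one_pos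
    refine Integrable.mono' hi
      ((hc.mono (Ioi_subset_Ioi zero_le_one)).aestronglyMeasurable measurableSet_Ioi) ?_
    filter_upwards [ae_restrict_mem measurableSet_Ioi] with x hx
    have hx0 : 0 < x := one_pos.trans hx
    have h0 : 0 ≤ 1 - Real.exp (-x) := sub_nonneg.2 (Real.exp_le_one_iff.2 (by linarith))
    rw [Real.norm_of_nonneg (by positivity)]
    exact mul_le_of_le_one_right (by positivity) (by linarith [Real.exp_pos (-x)])

open MeasureTheory Set in
theorem setIntegral_rpow_mul_one_sub_exp_mul {a m : ℝ} (ha : 0 < a) (ha1 : a < 1) (hm : 0 < m) :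
    IntegrableOn (fun x : ℝ => x ^ (a - 2) * (1 - Real.exp (-(m * x)))) (Ioi 0) ∧
    ∫ x in Ioi 0, x ^ (a - 2) * (1 - Real.exp (-(m * x))) =
      (∫ x in Ioi 0, x ^ (a - 2) * (1 - Real.exp (-x))) * m ^ (-(a - 1)) := by
  have e : ∀ x ∈ Ioi (0 : ℝ), m ^ (-(a - 2)) * ((m * x) ^ (a - 2) * (1 - Real.exp (-(m * x)))) =
      x ^ (a - 2) * (1 - Real.exp (-(m * x))) := fun x hx => by
    rw [Real.mul_rpow hm.le (le_of_lt hx), Real.rpow_neg hm.le]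
    have := (Real.rpow_pos_of_pos hm (a - 2)).ne'
    field_simp
  constructor
  · have h := integrableOn_rpow_mul_one_sub_exp ha ha1
    rw [← mul_zero m, ← integrableOn_Ioi_comp_mul_left_iff _ _ hm] at h
    exact IntegrableOn.congr_fun (h.const_mul (m ^ (-(a - 2)))) e measurableSet_Ioi
  · rw [← setIntegral_congr_fun measurableSet_Ioi e, integral_const_mul,
      integral_comp_mul_left_Ioi (fun x : ℝ => x ^ (a - 2) * (1 - Real.exp (-x))) 0 hm, mul_zero,
      smul_eq_mul, ← mul_assoc, ← Real.rpow_neg_one m, ← Real.rpow_add hm, mul_comm]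
    ring_nf

-- The Gamma integral diverges at exponent `a - 1 < 0`. Replacing `e^{-mx}` by `1 - e^{-mx}`
-- regularises it, and scaling still gives a multiple of `m ^ (1 - a)`. Summing over `m = n + 1`
-- leaves a difference of two geometric series, from which `(1 - z)⁻¹` factors out.
open MeasureTheory Set in
theorem const_mul_polylogQuot_sub_one {a : ℝ} (ha : 0 < a) (ha1 : a < 1) {z : ℂ} (hz : ‖z‖ < 1) :
    ((∫ x in Ioi 0, x ^ (a - 2) * (1 - Real.exp (-x)) : ℝ) : ℂ) * polylogQuot (a - 1) z =
      (1 - z)⁻¹ *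
        ∫ x in Ioi 0, ((x ^ (a - 2) * (1 - Real.exp (-x)) : ℝ) : ℂ) * geomKernel z x := by
  rw [mul_polylogQuot_eq_setIntegral (by linarith)
    (φ := fun n x => x ^ (a - 2) * (1 - Real.exp (-(((n : ℝ) + 1) * x))))
    (fun n => (setIntegral_rpow_mul_one_sub_exp_mul ha ha1 (by positivity)).1)
    (fun n x hx => mul_nonneg (by positivity)
      (sub_nonneg.2 (Real.exp_le_one_iff.2 (neg_nonpos.2 (by positivity)))))
    (fun n => (setIntegral_rpow_mul_one_sub_exp_mul ha ha1 (by positivity)).2) hz,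
    ← integral_const_mul]
  refine setIntegral_congr_fun measurableSet_Ioi fun x hx => ?_
  have hx0 : (0 : ℝ) ≤ x := le_of_lt hx
  have h := (((hasSum_geometric_of_norm_lt_one hz).sub (hasSum_exp_neg_mul_pow hz hx0)).mul_left
    ((x ^ (a - 2) : ℝ) : ℂ)).tsum_eq
  have e : (1 - z)⁻¹ - (Real.exp (-x) : ℂ) * geomKernel z x =
      (1 - z)⁻¹ * ((1 - (Real.exp (-x) : ℂ)) * geomKernel z x) := by
    have h1 := mul_inv_cancel₀ (one_sub_ne_zero_of_norm_lt hz)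
    have h2 := mul_inv_cancel₀ (one_sub_ne_zero_of_norm_lt (norm_exp_mul_lt hz hx0))
    rw [geomKernel]
    linear_combination (Real.exp (-x) : ℂ) * (1 - (Real.exp (-x) : ℂ) * z)⁻¹ * h1 -
      (1 - z)⁻¹ * h2
  rw [e] at h
  trans ((x ^ (a - 2) : ℝ) : ℂ) * ((1 - z)⁻¹ * ((1 - (Real.exp (-x) : ℂ)) * geomKernel z x))
  · rw [← h]
    refine tsum_congr fun n => ?_
    push_cast
    ring
  · push_cast
    ring

/-! ### Starlikeness -/

theorem monotoneOn_exp_sub_one_div :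
    MonotoneOn (fun x : ℝ => (Real.exp x - 1) / x) (Set.Ioi 0) := by
  intro x hx y hy hxy
  have h := convexOn_exp.secant_mono (Set.mem_univ 0) (Set.mem_univ x) (Set.mem_univ y)
    (ne_of_gt hx) (ne_of_gt hy) hxy
  simpa using h

-- Up to positive constants `Q_a` is `F` and `Q_{a-1}` is `(1 - z)⁻¹ G`, where the weights of `G`
-- and `F` have the increasing ratio `v = (e^x - 1) / x`. Both integrals lie in the first quadrant,
-- so `Re (G conj F) > 0`, while `Im (G conj F) ≤ 0`. The remaining factor `conj (1 - z)` has
-- positive real part and imaginary part `Im z ≥ 0`, so the product keeps a positive real part.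
open MeasureTheory Set in
theorem polylogQuot_sub_one_mul_conj_re_pos_of_im_nonneg {a : ℝ} (ha : 0 < a) (ha1 : a < 1) {z : ℂ}
    (hz : ‖z‖ < 1) (hzi : 0 ≤ z.im) :
    0 < (polylogQuot (a - 1) z * (starRingEnd ℂ) (polylogQuot a z)).re := by
  set w : ℝ → ℝ := fun x => x ^ (a - 1) * Real.exp (-x) with hwdef
  set v : ℝ → ℝ := fun x => (Real.exp x - 1) / x with hvdef
  have hw : IntegrableOn w (Ioi 0) := by
    simpa using integrableOn_rpow_mul_exp_neg_mul ha one_pos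
  have hw0 : ∀ x, 0 < x → 0 < w x := fun x hx => by positivity
  have hv0 : ∀ x, 0 < x → 0 < v x := fun x hx =>
    div_pos (sub_pos.2 (Real.one_lt_exp_iff.2 hx)) hx
  have hvw : ∀ x ∈ Ioi (0 : ℝ), x ^ (a - 2) * (1 - Real.exp (-x)) = v x * w x := fun x hx => by
    have hx0 : (0 : ℝ) < x := hx
    rw [hvdef, hwdef, show a - 1 = (a - 2) + 1 by ring]
    simp only
    rw [Real.rpow_add_one hx0.ne', Real.exp_neg]
    have := Real.exp_pos x
    field_simp
  have hi := (integrableOn_rpow_mul_one_sub_exp ha ha1).congr_fun hvw measurableSet_Ioi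
  have hF := Gamma_mul_polylogQuot ha hz
  have hG := const_mul_polylogQuot_sub_one ha ha1 hz
  have hC : 0 < ∫ x in Ioi 0, x ^ (a - 2) * (1 - Real.exp (-x)) := by
    rw [setIntegral_congr_fun measurableSet_Ioi hvw]
    exact setIntegral_Ioi_pos hi fun x hx => mul_pos (hv0 x hx) (hw0 x hx)
  set C := ∫ x in Ioi 0, x ^ (a - 2) * (1 - Real.exp (-x))
  have hΓ := Real.Gamma_pos_of_pos ha
  rw [setIntegral_congr_fun (g := fun x => ((v x * w x : ℝ) : ℂ) * geomKernel z x)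
    measurableSet_Ioi (fun x hx => by simp only; rw [hvw x hx])] at hG
  have him := setIntegral_mul_conj_im_nonpos hw hi hw0 hv0 monotoneOn_exp_sub_one_div hz hzi
  have hF1 := setIntegral_geomKernel_re_pos hw hw0 hz
  have hF2 := setIntegral_geomKernel_im_nonneg hw hw0 hz hzi
  have hvw0 : ∀ x, 0 < x → 0 < v x * w x := fun x hx => mul_pos (hv0 x hx) (hw0 x hx)
  have hG1 := setIntegral_geomKernel_re_pos hi hvw0 hz
  have hG2 := setIntegral_geomKernel_im_nonneg hi hvw0 hz hzi
  change (Real.Gamma a : ℂ) * polylogQuot a z = ∫ x in Ioi 0, (w x : ℂ) * geomKernel z x at hF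
  set F := ∫ x in Ioi 0, (w x : ℂ) * geomKernel z x
  set G := ∫ x in Ioi 0, ((v x * w x : ℝ) : ℂ) * geomKernel z x
  have hre : 0 < (G * (starRingEnd ℂ) F).re := by
    rw [Complex.mul_re, Complex.conj_re, Complex.conj_im]
    nlinarith [mul_pos hG1 hF1, mul_nonneg hG2 hF2]
  have h1z := re_one_sub_pos hz
  have hne := one_sub_ne_zero_of_norm_lt hz
  have e : ((C * Real.Gamma a * Complex.normSq (1 - z) : ℝ) : ℂ) *
      (polylogQuot (a - 1) z * (starRingEnd ℂ) (polylogQuot a z)) =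
      G * (starRingEnd ℂ) F * (starRingEnd ℂ) (1 - z) := by
    rw [← hF, map_mul, Complex.conj_ofReal]
    have hG' : G = (1 - z) * (C * polylogQuot (a - 1) z) := by
      rw [hG, ← mul_assoc, mul_inv_cancel₀ hne, one_mul]
    rw [hG']
    push_cast
    rw [← Complex.mul_conj]
    ring
  have e2 := congrArg Complex.re e
  rw [Complex.re_ofReal_mul, Complex.mul_re (G * _), Complex.conj_re, Complex.conj_im] at e2
  have h3 : (1 - z).im = -z.im := by simp
  rw [h3, neg_neg] at e2
  have h4 : 0 < C * Real.Gamma a * Complex.normSq (1 - z) :=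
    mul_pos (mul_pos hC hΓ) (Complex.normSq_pos.2 hne)
  refine pos_of_mul_pos_right (lt_of_lt_of_eq ?_ e2.symm) h4.le
  nlinarith [mul_pos hre h1z, mul_nonneg (neg_nonneg.2 him) hzi]

theorem polylogQuot_conj (s : ℝ) (z : ℂ) :
    polylogQuot s ((starRingEnd ℂ) z) = (starRingEnd ℂ) (polylogQuot s z) := by
  rw [polylogQuot, polylogQuot, Complex.conj_tsum]
  refine tsum_congr fun n => ?_
  rw [map_mul, map_pow, Complex.conj_ofReal]

theorem polylogQuot_zero {z : ℂ} (hz : ‖z‖ < 1) : polylogQuot 0 z = (1 - z)⁻¹ := by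
  simp [polylogQuot, tsum_geometric_of_norm_lt_one hz]

theorem polylogQuot_neg_one {z : ℂ} (hz : ‖z‖ < 1) : polylogQuot (-1) z = ((1 - z) ^ 2)⁻¹ := by
  have h := (hasSum_coe_mul_geometric_of_norm_lt_one hz).add (hasSum_geometric_of_norm_lt_one hz)
  have hne := one_sub_ne_zero_of_norm_lt hz
  rw [polylogQuot]
  refine Eq.trans (tsum_congr fun n => ?_) (h.tsum_eq.trans ?_)
  · simp
    ring
  · field_simp
    ring

/-- `Li_s` is starlike for every `s ≥ 0`. -/
theorem polylogQuot_sub_one_mul_conj_re_pos {a : ℝ} (ha : 0 ≤ a) {z : ℂ} (hz : ‖z‖ < 1) :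
    0 < (polylogQuot (a - 1) z * (starRingEnd ℂ) (polylogQuot a z)).re := by
  rcases le_or_gt 1 a with h1 | h1
  · obtain ⟨u, hu, h⟩ := exists_polylogQuot_eq (sub_nonneg.2 h1) (sub_one_lt a).le hz
    rw [h, map_mul, mul_left_comm, Complex.mul_conj, Complex.re_mul_ofReal, Complex.conj_re]
    exact mul_pos (re_one_sub_pos hu)
      (Complex.normSq_pos.2 (polylogQuot_ne_zero (sub_nonneg.2 h1) hz))
  rcases ha.eq_or_lt with rfl | h0
  · rw [zero_sub, polylogQuot_zero hz, polylogQuot_neg_one hz, sq, mul_inv, mul_assoc,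
      Complex.mul_conj, Complex.re_mul_ofReal, Complex.inv_re]
    have hn := Complex.normSq_pos.2 (one_sub_ne_zero_of_norm_lt hz)
    exact mul_pos (div_pos (re_one_sub_pos hz) hn)
      (Complex.normSq_pos.2 (inv_ne_zero (one_sub_ne_zero_of_norm_lt hz)))
  · rcases le_total 0 z.im with hi | hi
    · exact polylogQuot_sub_one_mul_conj_re_pos_of_im_nonneg h0 h1 hz hi
    · have h := polylogQuot_sub_one_mul_conj_re_pos_of_im_nonneg h0 h1
        (z := (starRingEnd ℂ) z) (by simpa using hz) (by simpa using hi)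
      rwa [polylogQuot_conj, polylogQuot_conj, ← map_mul, Complex.conj_re] at h

/-! ### Images of circles have supporting lines -/

theorem hasDerivAt_circle (r θ : ℝ) :
    HasDerivAt (fun t : ℝ => (r : ℂ) * Complex.exp (t * Complex.I))
      (Complex.I * (r * Complex.exp (θ * Complex.I))) θ := by
  have h := (((Complex.ofRealCLM.hasDerivAt (x := θ)).mul_const Complex.I).cexp).const_mul (r : ℂ)
  refine h.congr_deriv ?_
  simp
  ring

theorem norm_circle {r : ℝ} (hr : 0 ≤ r) (θ : ℝ) :
    ‖(r : ℂ) * Complex.exp (θ * Complex.I)‖ = r := by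
  rw [norm_mul, Complex.norm_exp_ofReal_mul_I, mul_one, Complex.norm_real, Real.norm_of_nonneg hr]

/-- The argument of `Li_s` along the circle of radius `r`. -/
noncomputable def polylogArg (s r θ : ℝ) : ℝ :=
  θ + (polylogQuot s (r * Complex.exp (θ * Complex.I))).arg

theorem polylog_circle_eq (s r θ : ℝ) : polylog s (r * Complex.exp (θ * Complex.I)) =
    ((r * ‖polylogQuot s (r * Complex.exp (θ * Complex.I))‖ : ℝ) : ℂ) *
      Complex.exp (polylogArg s r θ * Complex.I) := by
  rw [polylog_eq_mul, polylogArg]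
  conv_lhs => rw [← Complex.norm_mul_exp_arg_mul_I (polylogQuot s _)]
  push_cast
  rw [add_mul, Complex.exp_add]
  ring

theorem polylogArg_add_two_pi (s r θ : ℝ) :
    polylogArg s r (θ + 2 * Real.pi) = polylogArg s r θ + 2 * Real.pi := by
  rw [polylogArg, polylogArg]
  push_cast
  rw [add_mul, Complex.exp_periodic]
  ring

/-- The derivative is `Re (z Li_s' / Li_s) = Re (Q_{s-1} / Q_s)`, positive by starlikeness. The
principal argument of `Q_s` is smooth because `Re Q_s > 0`. -/
theorem strictMono_polylogArg {s r : ℝ} (hs : 0 ≤ s) (hr0 : 0 < r) (hr1 : r < 1) :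
    StrictMono (polylogArg s r) := by
  have hn : ∀ θ : ℝ, ‖(r : ℂ) * Complex.exp (θ * Complex.I)‖ < 1 := fun θ => by
    rwa [norm_circle hr0.le]
  refine strictMono_of_hasDerivAt_pos
    (f' := fun θ => (polylogQuot (s - 1) (r * Complex.exp (θ * Complex.I)) /
      polylogQuot s (r * Complex.exp (θ * Complex.I))).re) (fun θ => ?_) (fun θ => ?_)
  · set Z : ℝ → ℂ := fun t => (r : ℂ) * Complex.exp (t * Complex.I) with hZ
    have hZ0 : ∀ t, Z t ≠ 0 := fun t => norm_pos_iff.1 (by rw [hZ, norm_circle hr0.le]; exact hr0)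
    have hZd : HasDerivAt Z (Complex.I * Z θ) θ := hasDerivAt_circle r θ
    have hS : HasDerivAt (fun t => polylog s (Z t))
        (polylogQuot (s - 1) (Z θ) * (Complex.I * Z θ)) θ :=
      HasDerivAt.comp (h₂ := polylog s) θ (hasDerivAt_polylog hs (hn θ)) hZd
    have hF : HasDerivAt (fun t => polylogQuot s (Z t))
        (Complex.I * (polylogQuot (s - 1) (Z θ) - polylogQuot s (Z θ))) θ := by
      have h := hS.div hZd (hZ0 θ)
      have e : (fun t => polylogQuot s (Z t)) = (fun t => polylog s (Z t)) / Z := by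
        funext t
        rw [Pi.div_apply, polylog_eq_mul, mul_div_cancel_left₀ _ (hZ0 t)]
      rw [e]
      refine h.congr_deriv ?_
      rw [polylog_eq_mul]
      have := hZ0 θ
      field_simp
    have hne := polylogQuot_ne_zero hs (hn θ)
    have hlog := hF.clog_real (Or.inl (polylogQuot_re_pos hs (hn θ)))
    have him := (Complex.imCLM.hasFDerivAt.comp_hasDerivAt θ hlog)
    have h := (hasDerivAt_id θ).add him
    refine (h.congr_of_eventuallyEq (Filter.Eventually.of_forall fun t => ?_)).congr_deriv ?_
    · simp [polylogArg, hZ, Complex.log_im]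
    · change 1 + (Complex.I * (polylogQuot (s - 1) (Z θ) - polylogQuot s (Z θ)) /
        polylogQuot s (Z θ)).im = (polylogQuot (s - 1) (Z θ) / polylogQuot s (Z θ)).re
      rw [mul_div_assoc, Complex.I_mul_im, sub_div, div_self hne, Complex.sub_re, Complex.one_re]
      ring
  · have h := polylogQuot_sub_one_mul_conj_re_pos hs (hn θ)
    have hne := polylogQuot_ne_zero hs (hn θ)
    rw [div_eq_mul_inv, Complex.inv_def, ← mul_assoc, Complex.re_mul_ofReal]
    exact mul_pos h (inv_pos.2 (Complex.normSq_pos.2 hne))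

/-- `A = z h'(z)` at `θ₁` is the outward normal of the image curve. The height `T` of the curve in
this direction has derivative a positive multiple of `sin (Θ θ₁ - Θ θ)`, where the tangent angle `Θ`
increases by `2π` per turn; hence the curve is highest at `θ₁`. -/
theorem polylog_circle_supporting {α r θ₁ θ₂ : ℝ} (hα : 1 ≤ α) (hr0 : 0 < r) (hr1 : r < 1)
    (h12 : θ₂ < θ₁) (h21 : θ₁ < θ₂ + 2 * Real.pi) :
    (polylog α (r * Complex.exp (θ₂ * Complex.I)) *
      (starRingEnd ℂ) (polylog (α - 1) (r * Complex.exp (θ₁ * Complex.I)))).re <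
    (polylog α (r * Complex.exp (θ₁ * Complex.I)) *
      (starRingEnd ℂ) (polylog (α - 1) (r * Complex.exp (θ₁ * Complex.I)))).re := by
  have hα0 : 0 ≤ α - 1 := by linarith
  set Z : ℝ → ℂ := fun t => (r : ℂ) * Complex.exp (t * Complex.I) with hZ
  have hn : ∀ θ : ℝ, ‖Z θ‖ < 1 := fun θ => by rwa [hZ, norm_circle hr0.le]
  set A := polylog (α - 1) (Z θ₁) with hA
  set Θ := polylogArg (α - 1) r with hΘ
  have hmono : StrictMono Θ := strictMono_polylogArg hα0 hr0 hr1
  set M : ℝ → ℝ := fun θ => r * ‖polylogQuot (α - 1) (Z θ)‖ with hM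
  have hMpos : ∀ θ, 0 < M θ := fun θ =>
    mul_pos hr0 (norm_pos_iff.2 (polylogQuot_ne_zero hα0 (hn θ)))
  set T : ℝ → ℝ := fun θ => (polylog α (Z θ) * (starRingEnd ℂ) A).re with hT
  have hTd : ∀ θ, HasDerivAt T (M θ * M θ₁ * Real.sin (Θ θ₁ - Θ θ)) θ := by
    intro θ
    have h1 : HasDerivAt (fun t => polylog α (Z t))
        (polylogQuot (α - 1) (Z θ) * (Complex.I * Z θ)) θ :=
      (hasDerivAt_polylog (by linarith) (hn θ)).comp θ (hasDerivAt_circle r θ)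
    have h2 := Complex.reCLM.hasFDerivAt.comp_hasDerivAt θ (h1.mul_const ((starRingEnd ℂ) A))
    refine h2.congr_deriv ?_
    have e : polylogQuot (α - 1) (Z θ) * (Complex.I * Z θ) * (starRingEnd ℂ) A =
        Complex.I * (polylog (α - 1) (Z θ) * (starRingEnd ℂ) A) := by
      rw [polylog_eq_mul (α - 1) (Z θ)]; ring
    have e2 : polylog (α - 1) (Z θ) * (starRingEnd ℂ) A =
        ((M θ * M θ₁ : ℝ) : ℂ) * Complex.exp ((Θ θ - Θ θ₁ : ℝ) * Complex.I) := by
      simp only [hA, hM, hΘ, hZ]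
      rw [polylog_circle_eq, polylog_circle_eq, map_mul, Complex.conj_ofReal, ← Complex.exp_conj,
        map_mul, Complex.conj_ofReal, Complex.conj_I]
      push_cast
      rw [sub_mul, sub_eq_add_neg (_ * Complex.I), Complex.exp_add, mul_neg]
      ring
    rw [e, e2, Complex.reCLM_apply, Complex.I_mul_re, Complex.im_ofReal_mul,
      Complex.exp_ofReal_mul_I_im, ← neg_sub (Θ θ₁), Real.sin_neg]
    ring
  have hTc : Continuous T := continuous_iff_continuousAt.2 fun θ => (hTd θ).continuousAt
  change T θ₂ < T θ₁
  -- Choose the arc between the two points on which `Θ` turns by at most `π`: either `T` rises from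
  -- `θ₂` to `θ₁`, or it falls from `θ₁` to `θ₂ + 2π`.
  rcases le_or_gt (Θ θ₁ - Θ θ₂) Real.pi with hle | hgt
  · refine strictMonoOn_of_deriv_pos (convex_Icc θ₂ θ₁) hTc.continuousOn (fun θ hθ => ?_)
      (Set.left_mem_Icc.2 h12.le) (Set.right_mem_Icc.2 h12.le) h12
    rw [interior_Icc] at hθ
    rw [(hTd θ).deriv]
    refine mul_pos (mul_pos (hMpos _) (hMpos _)) (Real.sin_pos_of_pos_of_lt_pi ?_ ?_)
    · linarith [hmono hθ.2]
    · linarith [hmono hθ.1]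
  · have hper : T (θ₂ + 2 * Real.pi) = T θ₂ := by
      simp only [hT, hZ]
      push_cast
      rw [add_mul, Complex.exp_periodic]
    rw [← hper]
    refine strictAntiOn_of_deriv_neg (convex_Icc θ₁ (θ₂ + 2 * Real.pi)) hTc.continuousOn
      (fun θ hθ => ?_) (Set.left_mem_Icc.2 h21.le) (Set.right_mem_Icc.2 h21.le) h21
    rw [interior_Icc] at hθ
    rw [(hTd θ).deriv]
    refine mul_neg_of_pos_of_neg (mul_pos (hMpos _) (hMpos _))
      (Real.sin_neg_of_neg_of_neg_pi_lt ?_ ?_)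
    · linarith [hmono hθ.1]
    · have h1 := hmono hθ.2
      have h2 : Θ (θ₂ + 2 * Real.pi) = Θ θ₂ + 2 * Real.pi := polylogArg_add_two_pi _ _ _
      linarith

theorem polylog_supporting {α r : ℝ} (hα : 1 ≤ α) (hr0 : 0 < r) (hr1 : r < 1) {a b : ℂ}
    (ha : ‖a‖ = r) (hb : ‖b‖ = r) (hab : a ≠ b) :
    0 < ((polylog α a - polylog α b) * (starRingEnd ℂ) (a * polylogQuot (α - 1) a)).re := by
  rw [← polylog_eq_mul, sub_mul, Complex.sub_re, sub_pos]
  have ea : a = r * Complex.exp (a.arg * Complex.I) := by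
    rw [← ha, Complex.norm_mul_exp_arg_mul_I]
  have eb : b = r * Complex.exp (b.arg * Complex.I) := by
    rw [← hb, Complex.norm_mul_exp_arg_mul_I]
  have ha1 := Complex.neg_pi_lt_arg a
  have ha2 := Complex.arg_le_pi a
  have hb1 := Complex.neg_pi_lt_arg b
  have hb2 := Complex.arg_le_pi b
  rcases lt_trichotomy b.arg a.arg with h | h | h
  · have := polylog_circle_supporting hα hr0 hr1 h (by linarith)
    rwa [← ea, ← eb] at this
  · exact absurd (by rw [ea, eb, h]) hab
  · have h2 : (r : ℂ) * Complex.exp ((a.arg + 2 * Real.pi : ℝ) * Complex.I) = a := by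
      push_cast
      rw [add_mul, Complex.exp_periodic, ← ea]
    have := polylog_circle_supporting hα hr0 hr1 (θ₁ := a.arg + 2 * Real.pi) (θ₂ := b.arg)
      (by linarith) (by linarith)
    rwa [h2, ← eb] at this

/-! ### Injectivity, Wirtinger derivatives and the main theorem -/

/-- The Noshiro–Warschawski theorem. -/
theorem injOn_of_re_deriv_pos {h h' : ℂ → ℂ} {s : Set ℂ} (hs : Convex ℝ s)
    (hh : ∀ z ∈ s, HasDerivAt h (h' z) z) (hre : ∀ z ∈ s, 0 < (h' z).re) : Set.InjOn h s := by
  intro a ha b hb hab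
  by_contra hne
  set v := b - a with hv
  have hv0 : 0 < Complex.normSq v := Complex.normSq_pos.2 (sub_ne_zero.2 (Ne.symm hne))
  have hmem : ∀ t ∈ Set.Icc (0 : ℝ) 1, a + (t : ℂ) * v ∈ s := fun t ht => by
    have := hs.add_smul_sub_mem ha hb ht
    rwa [Complex.real_smul] at this
  have hd : ∀ t ∈ Set.Icc (0 : ℝ) 1,
      HasDerivAt (fun t : ℝ => (h (a + (t : ℂ) * v) * (starRingEnd ℂ) v).re)
        ((h' (a + (t : ℂ) * v)).re * Complex.normSq v) t := by
    intro t ht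
    have hline : HasDerivAt (fun t : ℝ => a + (t : ℂ) * v) v t := by
      simpa using ((Complex.ofRealCLM.hasDerivAt (x := t)).mul_const v).const_add a
    have h1 := HasDerivAt.comp (h₂ := h) t (hh _ (hmem t ht)) hline
    have h2 := Complex.reCLM.hasFDerivAt.comp_hasDerivAt t (h1.mul_const ((starRingEnd ℂ) v))
    refine h2.congr_deriv ?_
    rw [Complex.reCLM_apply, mul_assoc, Complex.mul_conj, Complex.re_mul_ofReal]
  have hmono := strictMonoOn_of_deriv_pos (convex_Icc (0 : ℝ) 1)
    (fun t ht => (hd t ht).continuousAt.continuousWithinAt) (fun t ht => by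
      rw [interior_Icc] at ht
      have ht' := Set.Ioo_subset_Icc_self ht
      rw [(hd t ht').deriv]
      exact mul_pos (hre _ (hmem t ht')) hv0)
  have := hmono (Set.left_mem_Icc.2 zero_le_one) (Set.right_mem_Icc.2 zero_le_one) one_pos
  simp [hv, hab] at this

theorem hasFDerivAt_add_mul_conj {h g : ℂ → ℂ} {h' g' z : ℂ} (c : ℂ) (hh : HasDerivAt h h' z)
    (hg : HasDerivAt g g' z) :
    ∃ L : ℂ →L[ℝ] ℂ, HasFDerivAt (fun w => h w + c * (starRingEnd ℂ) (g w)) L z ∧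
      ∀ v, L v = v * h' + c * (starRingEnd ℂ) (v * g') := by
  have h1 := hh.hasFDerivAt.restrictScalars ℝ
  have h2 := (Complex.conjCLE.toContinuousLinearMap.hasFDerivAt.comp z
    (hg.hasFDerivAt.restrictScalars ℝ)).const_mul c
  exact ⟨_, h1.add h2, fun v => by simp⟩

theorem wirtingerDz_add_mul_conj {h g : ℂ → ℂ} {h' g' z : ℂ} (c : ℂ) (hh : HasDerivAt h h' z)
    (hg : HasDerivAt g g' z) :
    wirtingerDz (fun w => h w + c * (starRingEnd ℂ) (g w)) z = h' := by
  obtain ⟨L, hL, hv⟩ := hasFDerivAt_add_mul_conj c hh hg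
  rw [wirtingerDz, hL.fderiv, hv, hv, map_mul, map_mul, Complex.conj_I, map_one]
  linear_combination (-h' / 2 + c * (starRingEnd ℂ) g' / 2) * Complex.I_mul_I

theorem wirtingerDzbar_add_mul_conj {h g : ℂ → ℂ} {h' g' z : ℂ} (c : ℂ) (hh : HasDerivAt h h' z)
    (hg : HasDerivAt g g' z) :
    wirtingerDzbar (fun w => h w + c * (starRingEnd ℂ) (g w)) z = c * (starRingEnd ℂ) g' := by
  obtain ⟨L, hL, hv⟩ := hasFDerivAt_add_mul_conj c hh hg
  rw [wirtingerDzbar, hL.fderiv, hv, hv, map_mul, map_mul, Complex.conj_I, map_one]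
  linear_combination (h' / 2 - c * (starRingEnd ℂ) g' / 2) * Complex.I_mul_I

open InnerProductSpace in
theorem harmonicOnNhd_polylog {s : ℝ} (hs : 0 ≤ s) :
    HarmonicOnNhd (polylog s) (Metric.ball 0 1) := by
  have hd : DifferentiableOn ℂ (polylog s) (Metric.ball 0 1) := fun z hz =>
    (hasDerivAt_polylog hs (by simpa using hz)).differentiableAt.differentiableWithinAt
  exact fun z hz => (hd.analyticAt (Metric.isOpen_ball.mem_nhds hz)).harmonicAt

theorem isHarmonicQuasiconformalOn_polylog {α β c k : ℝ} (hα : 1 ≤ α) (hβ : 1 ≤ β) (hc : 0 ≤ c)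
    (hk1 : k < 1) (hbound : ∀ z : ℂ, ‖z‖ < 1 →
      c * ‖polylogQuot (β - 1) z‖ ≤ k * ‖polylogQuot (α - 1) z‖) :
    IsHarmonicQuasiconformalOn k
      (fun z => polylog α z + (c : ℂ) * (starRingEnd ℂ) (polylog β z))
      (Metric.ball (0 : ℂ) 1) := by
  have hα0 : 0 ≤ α - 1 := by linarith
  have hh : ∀ z : ℂ, ‖z‖ < 1 → HasDerivAt (polylog α) (polylogQuot (α - 1) z) z :=
    fun z hz => hasDerivAt_polylog (by linarith) hz
  have hg : ∀ z : ℂ, ‖z‖ < 1 → HasDerivAt (polylog β) (polylogQuot (β - 1) z) z :=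
    fun z hz => hasDerivAt_polylog (by linarith) hz
  have hne : ∀ z : ℂ, ‖z‖ < 1 → polylogQuot (α - 1) z ≠ 0 := fun z hz =>
    polylogQuot_ne_zero hα0 hz
  -- Forced by the bound at `z = 0`, where the left side is nonnegative.
  have hk0 : 0 ≤ k := by
    have h1 := hbound 0 (by simp)
    have h2 := norm_pos_iff.2 (hne 0 (by simp))
    by_contra hlt
    have := mul_neg_of_neg_of_pos (not_le.1 hlt) h2
    have h3 : 0 ≤ c * ‖polylogQuot (β - 1) 0‖ := by positivity
    linarith
  have hinj : Set.InjOn (polylog α) (Metric.ball 0 1) :=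
    injOn_of_re_deriv_pos (convex_ball 0 1) (fun z hz => hh z (by simpa using hz))
      fun z hz => polylogQuot_re_pos hα0 (by simpa using hz)
  have hbar : ∀ z : ℂ, ‖z‖ < 1 →
      ‖(c : ℂ) * (starRingEnd ℂ) (polylogQuot (β - 1) z)‖ ≤ k * ‖polylogQuot (α - 1) z‖ := by
    intro z hz
    rw [norm_mul, Complex.norm_real, Real.norm_of_nonneg hc, RCLike.norm_conj]
    exact hbound z hz
  refine ⟨?_, ?_, ?_, hk1, ?_⟩
  · have h1 := (harmonicOnNhd_polylog (by linarith : 0 ≤ β)).comp_CLM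
      Complex.conjCLE.toContinuousLinearMap
    have h2 := (harmonicOnNhd_polylog (by linarith : 0 ≤ α)).add (h1.const_smul (c := c))
    convert h2 using 1
    funext z
    simp
  · intro x hx y hy hxy
    simp only [mem_ball_zero_iff] at hx hy
    obtain ⟨r, hr, hr1⟩ := exists_between (max_lt hx hy)
    have hxr : ‖x‖ < r := (le_max_left _ _).trans_lt hr
    have hr0 : 0 < r := (norm_nonneg x).trans_lt hxr
    -- The extremal argument gives a Lipschitz constant only strictly above `k`; any `k' < 1` still
    -- makes the contraction strict.
    obtain ⟨k', hkk, hk'⟩ := exists_between hk1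
    have hlip := norm_sub_le_of_supporting (h := polylog α) (g := fun z => c * polylog β z)
      (h' := polylogQuot (α - 1)) (g' := fun z => c * polylogQuot (β - 1) z) hk0 hkk
      (fun z hz => hh z (hz.trans_lt hr1)) (fun z hz => (hg z (hz.trans_lt hr1)).const_mul _)
      (fun z hz => hne z (hz.trans_lt hr1)) (fun z hz => by
        rw [norm_mul, Complex.norm_real, Real.norm_of_nonneg hc]
        exact hbound z (hz.trans_lt hr1))
      (hinj.mono (Metric.closedBall_subset_ball hr1))
      (fun a b ha hb hab => polylog_supporting hα hr0 hr1 ha hb hab) hxr.le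
      ((le_max_right _ _).trans hr.le)
    have e : polylog α x - polylog α y =
        -(starRingEnd ℂ) (c * polylog β x - c * polylog β y) := by
      simp only [map_sub, map_mul, Complex.conj_ofReal]
      linear_combination hxy
    have hn : ‖polylog α x - polylog α y‖ = ‖(c : ℂ) * polylog β x - c * polylog β y‖ := by
      rw [e, norm_neg, RCLike.norm_conj]
    rw [← hn] at hlip
    have h0 : ‖polylog α x - polylog α y‖ = 0 := by
      have := norm_nonneg (polylog α x - polylog α y)
      nlinarith
    exact hinj (by simpa using hx) (by simpa using hy) (sub_eq_zero.1 (norm_eq_zero.1 h0))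
  · intro z hz
    rw [mem_ball_zero_iff] at hz
    rw [wirtingerJacobian, wirtingerDz_add_mul_conj _ (hh z hz) (hg z hz),
      wirtingerDzbar_add_mul_conj _ (hh z hz) (hg z hz), sub_pos]
    refine pow_lt_pow_left₀ ((hbar z hz).trans_lt ?_) (norm_nonneg _) two_ne_zero
    exact mul_lt_of_lt_one_left (norm_pos_iff.2 (hne z hz)) hk1
  · intro z hz
    rw [mem_ball_zero_iff] at hz
    rw [secondDilatation, wirtingerDz_add_mul_conj _ (hh z hz) (hg z hz),
      wirtingerDzbar_add_mul_conj _ (hh z hz) (hg z hz), norm_div, RCLike.norm_conj]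
    exact div_le_of_le_mul₀ (norm_nonneg _) hk0 (hbar z hz)

theorem theorem1p7 (α β c : ℝ) (hα : 1 ≤ α) (hβ : 1 ≤ β) (hc : 0 ≤ c) :
    (∀ k : ℝ, α ≤ β → 2 * c ≤ k → k < 1 →
      IsHarmonicQuasiconformalOn k
        (fun z => polylog α z + (c : ℂ) * (starRingEnd ℂ) (polylog β z))
        (Metric.ball (0 : ℂ) 1)) ∧
    (∀ k : ℝ, 2 < β → β ≤ α →
      c * (riemannZeta ((β - 1 : ℝ) : ℂ)).re / (riemannZeta ((α - 1 : ℝ) : ℂ)).re ≤ k → k < 1 →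
      IsHarmonicQuasiconformalOn k
        (fun z => polylog α z + (c : ℂ) * (starRingEnd ℂ) (polylog β z))
        (Metric.ball (0 : ℂ) 1)) := by
  refine ⟨fun k hαβ hck hk1 => ?_, fun k hβ2 hβα hck hk1 => ?_⟩
  · refine isHarmonicQuasiconformalOn_polylog hα hβ hc hk1 fun z hz => ?_
    have h := norm_polylogQuot_le_two_mul (sub_nonneg.2 hα) (sub_le_sub_right hαβ 1) hz
    calc c * ‖polylogQuot (β - 1) z‖ ≤ c * (2 * ‖polylogQuot (α - 1) z‖) :=
          mul_le_mul_of_nonneg_left h hc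
      _ = 2 * c * ‖polylogQuot (α - 1) z‖ := by ring
      _ ≤ k * ‖polylogQuot (α - 1) z‖ := mul_le_mul_of_nonneg_right hck (norm_nonneg _)
  · refine isHarmonicQuasiconformalOn_polylog hα hβ hc hk1 fun z hz => ?_
    have h := norm_polylogQuot_mul_zeta_le (b := β - 1) (a := α - 1) (by linarith)
      (by linarith) hz.le
    have hζ := riemannZeta_re_pos (b := α - 1) (by linarith)
    rw [div_le_iff₀ hζ] at hck
    refine le_of_mul_le_mul_right ?_ hζ
    calc c * ‖polylogQuot (β - 1) z‖ * (riemannZeta ((α - 1 : ℝ) : ℂ)).re =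
          c * (‖polylogQuot (β - 1) z‖ * (riemannZeta ((α - 1 : ℝ) : ℂ)).re) := by ring
      _ ≤ c * ((riemannZeta ((β - 1 : ℝ) : ℂ)).re * ‖polylogQuot (α - 1) z‖) :=
          mul_le_mul_of_nonneg_left h hc
      _ = c * (riemannZeta ((β - 1 : ℝ) : ℂ)).re * ‖polylogQuot (α - 1) z‖ := by ring
      _ ≤ k * (riemannZeta ((α - 1 : ℝ) : ℂ)).re * ‖polylogQuot (α - 1) z‖ :=
          mul_le_mul_of_nonneg_right hck (norm_nonneg _)
      _ = k * ‖polylogQuot (α - 1) z‖ * (riemannZeta ((α - 1 : ℝ) : ℂ)).re := by ring
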